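/- **Proposition (Killing tensors in warped products).** All objects are smooth ($C^\infty$); manifolds are finite dimensional and without boundary. On a pseudo-Riemannian manifold $(M,g)$ with contravariant metric $G$, let $S^2(M)$ be the set of symmetric contravariant 2-tensor fields; $K\in S^2(M)$ is a *Killing tensor* if the Schouten bracket $[K,G]$ vanishes, where in local coordinates $$[K,G]=2\,(K^{il}\,\partial_l G^{jk}-G^{il}\,\partial_l K^{jk})\,\partial_i\odot\partial_j\odot\partial_k .$$ A non-degenerate distribution $D\subseteq TM$ is *geodesic* if $(\nabla_XY)^{D^\perp}=0$ for all $X,Y\in\Gamma(D)$. It is *spherical* if there is $N\in\Gamma(D^\perp)$ with $(\nabla_XY)^{D^\perp}=\langle X,Y\rangle N$ and $(\nabla_XN)^{D^\perp}=0$ for all $X,Y\in\Gamma(D)$. It is *Killing* if $D$ is spherical and $D^\perp$ is geodesic. $D$ is *$K$-invariant* if the endomorphism of $TM$ obtained from $K$ by lowering an index maps $D$ into $D$. Let $(M,g)$ be a pseudo-Riemannian manifold, $K\in S^2(M)$, and $D$ a $K$-invariant Killing distribution on $M$. Let $(B,g_B)$ and $(F,g_F)$ be connected pseudo-Riemannian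 manifolds with $\dim F>0$, let $\rho:B\to\mathbb R^+$, and let $B\times_\rho F$ be the warped product, that is, $B\times F$ with the metric $\pi_B^*g_B+\rho^2\pi_F^*g_F$. Suppose it is a local warped product adapted to $(D^\perp,D)$: there is an isometry from $B\times_\rho F$ onto an open set $U\subseteq M$, by which we identify $B\times_\rho F$ with $U$, such that the slices $B\times\{y\}$ and $\{b\}\times F$ are integral manifolds of $D^\perp$ and $D$ respectively. Write $G=G_0+\kappa G_1$ on $U$, where $\kappa=\rho^{-2}$ and $G_0$, $G_1$ are the lifts to $B\times F$ of the contravariant metrics of $B$ and $F$. (The lift of a contravariant tensor field on a factor is its push-forward by the inclusions of the slices.) Then $K$ is a Killing tensor on $U$ if and only if there exist a Killing tensor $K'$ on $(B,g_B)$, a Killing tensor $\tilde K$ on $(F,g_F)$ and a function $t$ on $B$ such that, with tensors on the factors identified with their lifts, $$K=K'+t\,G_1+\tilde K\quad\text{on }U,\qquad dt=K'\,d\kappa ,$$ where in the last equation $K'$ acts on 1-forms on $B$ by means of $g_B$, i.e. $\partial_a t=(g_B)_{ab}K'^{bc}\partial_c\kappa$. Furthermore the lift of every Killing tensor $\tilde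 K$ on $(F,g_F)$ is a Killing tensor on $B\times_\rho F$. -/

import Mathlib

open scoped Manifold ContDiff Topology

noncomputable section

namespace WarpedKilling

/-! ### Tensor fields on a manifold -/

section Tensors

variable {E : Type*} [NormedAddCommGroup E] [NormedSpace ℝ E]
  {H : Type*} [TopologicalSpace H] (I : ModelWithCorners ℝ E H)
  (M : Type*) [TopologicalSpace M] [ChartedSpace H M]

/-- Vector fields on `M` (no regularity imposed). -/
abbrev VField : Type _ := Π x : M, TangentSpace I x

/-- Covariant 2-tensor fields on `M` (no regularity or symmetry imposed). -/
abbrev CovTensor : Type _ := Π x : M, TangentSpace I x →L[ℝ] TangentSpace I x →L[ℝ] ℝ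

/-- Contravariant 2-tensor fields on `M` (no regularity or symmetry imposed), seen as maps
`T*M → TM`. The value of `K` at `x` on two covectors `p`, `q` is `p (K x q)`. -/
abbrev ContraTensor : Type _ := Π x : M, (TangentSpace I x →L[ℝ] ℝ) →L[ℝ] TangentSpace I x

variable {M}

/-- A pseudo-Riemannian metric: a smooth symmetric covariant 2-tensor field which is
non-degenerate at each point. -/
structure IsPseudoRiemannianMetric [IsManifold I ∞ M] (g : CovTensor I M) : Prop where
  symm : ∀ (x : M) (v w : TangentSpace I x), g x v w = g x w v
  nondegenerate : ∀ (x : M) (v : TangentSpace I x), (∀ w, g x v w = 0) → v = 0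
  smooth : ContMDiff I (I.prod 𝓘(ℝ, E →L[ℝ] E →L[ℝ] ℝ)) ∞
    (fun x ↦ Bundle.TotalSpace.mk' (E →L[ℝ] E →L[ℝ] ℝ)
      (E := fun x : M ↦ TangentSpace I x →L[ℝ] TangentSpace I x →L[ℝ] ℝ) x (g x))

/-- The contravariant metric: at each point, the inverse of `v ↦ g(v, ·)`. -/
def cometric (g : CovTensor I M) : ContraTensor I M := fun x ↦ (g x).inverse

/-- `K ∈ S²(M)`: a smooth symmetric contravariant 2-tensor field. Smoothness says that the
function `K(df, dh)` is smooth for all locally defined smooth functions `f` and `h`. -/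
structure IsSymmetricTensorField (K : ContraTensor I M) : Prop where
  symm : ∀ (x : M) (p q : TangentSpace I x →L[ℝ] ℝ), p (K x q) = q (K x p)
  smooth : ∀ (x : M) (f h : M → ℝ), ContMDiffAt I 𝓘(ℝ, ℝ) ∞ f x → ContMDiffAt I 𝓘(ℝ, ℝ) ∞ h x →
    ContMDiffAt I 𝓘(ℝ, ℝ) ∞ (fun y ↦ mvfderiv I f y (K y (mvfderiv I h y))) x

/-- The Schouten bracket `[K, G]` of two symmetric contravariant 2-tensor fields, a symmetric
contravariant 3-tensor field, evaluated at `x` on the differentials of `f₁`, `f₂`, `f₃`.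
When the `fᵢ` are coordinate functions this is the component of
`2 (K dGʲᵏ - G dKʲᵏ) ⊙ ∂ⱼ ⊙ ∂ₖ`, where `⊙` is the symmetrized tensor product; the second
derivatives of the `fᵢ` cancel in the cyclic sum, so the value depends only on `dfᵢ(x)`. -/
def schouten (K G : ContraTensor I M) (f₁ f₂ f₃ : M → ℝ) (x : M) : ℝ :=
  let b (f h : M → ℝ) (T : ContraTensor I M) : M → ℝ :=
    fun y ↦ mvfderiv I f y (T y (mvfderiv I h y))
  let c (u f h : M → ℝ) : ℝ :=
    mvfderiv I (b f h G) x (K x (mvfderiv I u x)) - mvfderiv I (b f h K) x (G x (mvfderiv I u x))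
  (2 / 3 : ℝ) * (c f₁ f₂ f₃ + c f₂ f₃ f₁ + c f₃ f₁ f₂)

/-- The Killing equation `[K, G] = 0` holds at all points of the set `s`, where `G` is the
contravariant metric of `g`. -/
def KillingEquationOn (g : CovTensor I M) (K : ContraTensor I M) (s : Set M) : Prop :=
  ∀ x ∈ s, ∀ f₁ f₂ f₃ : M → ℝ, ContMDiffAt I 𝓘(ℝ, ℝ) ∞ f₁ x → ContMDiffAt I 𝓘(ℝ, ℝ) ∞ f₂ x →
    ContMDiffAt I 𝓘(ℝ, ℝ) ∞ f₃ x → schouten I K (cometric I g) f₁ f₂ f₃ x = 0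

/-- `K` is a Killing tensor of valence 2 on `(M, g)`. -/
structure IsKillingTensor (g : CovTensor I M) (K : ContraTensor I M) : Prop where
  isSymmetricTensorField : IsSymmetricTensorField I K
  killing : KillingEquationOn I g K Set.univ

end Tensors

/-! ### Distributions on a pseudo-Riemannian manifold -/

section Distributions

variable {E : Type*} [NormedAddCommGroup E] [NormedSpace ℝ E]
  {H : Type*} [TopologicalSpace H] (I : ModelWithCorners ℝ E H)
  (M : Type*) [TopologicalSpace M] [ChartedSpace H M]

/-- Families of subspaces of the tangent spaces. -/
abbrev Distribution : Type _ := Π x : M, Submodule ℝ (TangentSpace I x)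

variable {M}

/-- Pointwise orthogonal complement with respect to `g`. -/
def orthogonal (g : CovTensor I M) (D : Distribution I M) : Distribution I M := fun x ↦
  { carrier := {v | ∀ w ∈ D x, g x v w = 0}
    add_mem' := by
      intro a b ha hb w hw
      simp [ha w hw, hb w hw]
    zero_mem' := by
      intro w _
      simp
    smul_mem' := by
      intro c a ha w hw
      simp [ha w hw] }

/-- `D` is `K`-invariant: the endomorphism `v ↦ K(g(v, ·))` of `TM` maps `D` into itself. -/
def IsInvariant (g : CovTensor I M) (K : ContraTensor I M) (D : Distribution I M) : Prop :=
  ∀ (x : M), ∀ v ∈ D x, K x (g x v) ∈ D x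

variable [IsManifold I ∞ M]

/-- The vector field `X` is smooth at `x`. -/
def SmoothVFieldAt (X : VField I M) (x : M) : Prop :=
  ContMDiffAt I (I.prod 𝓘(ℝ, E)) ∞
    (fun y ↦ (Bundle.TotalSpace.mk' E y (X y) : TangentBundle I M)) x

/-- `X` is a smooth section of `D` near `x`. -/
def IsSectionAt (D : Distribution I M) (X : VField I M) (x : M) : Prop :=
  SmoothVFieldAt I X x ∧ ∀ᶠ y in 𝓝 x, X y ∈ D y

/-- `D` is a smooth subbundle of `TM`: near each point it has a smooth frame. -/
def IsSmoothDistribution (D : Distribution I M) : Prop :=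
  ∀ x : M, ∃ (m : ℕ) (X : Fin m → VField I M), (∀ i, SmoothVFieldAt I (X i) x) ∧
    ∀ᶠ y in 𝓝 x, LinearIndependent ℝ (fun i ↦ X i y) ∧
      Submodule.span ℝ (Set.range fun i ↦ X i y) = D y

/-- The metric induced on `D` is non-degenerate. -/
def IsNondegenerate (g : CovTensor I M) (D : Distribution I M) : Prop :=
  ∀ (x : M), ∀ v ∈ D x, (∀ w ∈ D x, g x v w = 0) → v = 0

/-- The function `⟨X, Y⟩`. -/
def pairing (g : CovTensor I M) (X Y : VField I M) : M → ℝ := fun x ↦ g x (X x) (Y x)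

/-- `⟨∇_X Y, Z⟩` at `x` for the Levi-Civita connection `∇` of `g`, by the Koszul formula. -/
def leviCivita (g : CovTensor I M) (X Y Z : VField I M) (x : M) : ℝ :=
  (1 / 2 : ℝ) *
    (mvfderiv I (pairing I g Y Z) x (X x) + mvfderiv I (pairing I g X Z) x (Y x)
      - mvfderiv I (pairing I g X Y) x (Z x)
      + pairing I g (VectorField.mlieBracket I X Y) Z x
      - pairing I g (VectorField.mlieBracket I X Z) Y x
      - pairing I g (VectorField.mlieBracket I Y Z) X x)

/-- `D` is geodesic: the component of `∇_X Y` in `D^⊥` vanishes for all sections `X`, `Y`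
of `D`. -/
def IsGeodesic (g : CovTensor I M) (D : Distribution I M) : Prop :=
  ∀ (x : M) (X Y Z : VField I M), IsSectionAt I D X x → IsSectionAt I D Y x →
    IsSectionAt I (orthogonal I g D) Z x → leviCivita I g X Y Z x = 0

/-- `D` is umbilical with mean curvature normal `N`: the component of `∇_X Y` in `D^⊥` is
`⟨X, Y⟩ N` for all sections `X`, `Y` of `D`. If `D` is non-degenerate of positive rank `m`, taking
the trace shows that `N` is `1 / m` times the trace of the second fundamental form. -/
def IsUmbilicalWith (g : CovTensor I M) (D : Distribution I M) (N : VField I M) : Prop :=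
  (∀ x : M, IsSectionAt I (orthogonal I g D) N x) ∧
  ∀ (x : M) (X Y Z : VField I M), IsSectionAt I D X x → IsSectionAt I D Y x →
    IsSectionAt I (orthogonal I g D) Z x →
    leviCivita I g X Y Z x = pairing I g X Y x * pairing I g N Z x

/-- `D` is spherical: it is umbilical and its mean curvature normal `N` is parallel along `D` for
the connection induced on `D^⊥`, that is, the component of `∇_X N` in `D^⊥` vanishes for all
sections `X` of `D`. -/
def IsSpherical (g : CovTensor I M) (D : Distribution I M) : Prop :=
  ∃ N : VField I M, IsUmbilicalWith I g D N ∧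
    ∀ (x : M) (X Z : VField I M), IsSectionAt I D X x → IsSectionAt I (orthogonal I g D) Z x →
      leviCivita I g X N Z x = 0

/-- `D` is a Killing distribution: a non-degenerate spherical distribution whose orthogonal
complement is geodesic. -/
structure IsKillingDistribution (g : CovTensor I M) (D : Distribution I M) : Prop where
  smooth : IsSmoothDistribution I D
  nondegenerate : IsNondegenerate I g D
  spherical : IsSpherical I g D
  geodesic : IsGeodesic I g (orthogonal I g D)

end Distributions

/-! ### Warped products -/

section Pushforward

variable {E : Type*} [NormedAddCommGroup E] [NormedSpace ℝ E]
  {H : Type*} [TopologicalSpace H] (I : ModelWithCorners ℝ E H)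
  {N : Type*} [TopologicalSpace N] [ChartedSpace H N]
  {E' : Type*} [NormedAddCommGroup E'] [NormedSpace ℝ E']
  {H' : Type*} [TopologicalSpace H'] (J : ModelWithCorners ℝ E' H')
  {M : Type*} [TopologicalSpace M] [ChartedSpace H' M]

/-- Push-forward by `φ` of a contravariant 2-tensor at the point `x`:
`(φ_* T)(p, q) = T(p ∘ dφ, q ∘ dφ)`. -/
def pushforward (φ : N → M) (x : N)
    (T : (TangentSpace I x →L[ℝ] ℝ) →L[ℝ] TangentSpace I x) :
    (TangentSpace J (φ x) →L[ℝ] ℝ) →L[ℝ] TangentSpace J (φ x) :=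
  (mfderiv I J φ x) ∘L T ∘L (ContinuousLinearMap.precomp ℝ (mfderiv I J φ x))

/-- Pull-back by `φ` to the point `x` of a covariant 2-tensor at `φ x`:
`(φ^* T)(v, w) = T(dφ v, dφ w)`. -/
def pullback (φ : N → M) (x : N)
    (T : TangentSpace J (φ x) →L[ℝ] TangentSpace J (φ x) →L[ℝ] ℝ) :
    TangentSpace I x →L[ℝ] TangentSpace I x →L[ℝ] ℝ :=
  (ContinuousLinearMap.precomp ℝ (mfderiv I J φ x)) ∘L T ∘L (mfderiv I J φ x)

end Pushforward

section WarpedProducts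

variable {EB : Type*} [NormedAddCommGroup EB] [NormedSpace ℝ EB]
  {HB : Type*} [TopologicalSpace HB] (IB : ModelWithCorners ℝ EB HB)
  {B : Type*} [TopologicalSpace B] [ChartedSpace HB B]
  {EF : Type*} [NormedAddCommGroup EF] [NormedSpace ℝ EF]
  {HF : Type*} [TopologicalSpace HF] (IF : ModelWithCorners ℝ EF HF)
  {F : Type*} [TopologicalSpace F] [ChartedSpace HF F]

/-- The lift to `B × F` of a contravariant 2-tensor field on `B`. -/
def liftBase (K : ContraTensor IB B) : ContraTensor (IB.prod IF) (B × F) := fun z ↦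
  pushforward IB (IB.prod IF) (fun b : B ↦ (b, z.2)) z.1 (K z.1)

/-- The lift to `B × F` of a contravariant 2-tensor field on `F`. -/
def liftFiber (K : ContraTensor IF F) : ContraTensor (IB.prod IF) (B × F) := fun z ↦
  pushforward IF (IB.prod IF) (fun y : F ↦ (z.1, y)) z.2 (K z.2)

/-- The warped product metric `π_B^* g_B + ρ² π_F^* g_F` on `B × F`. -/
def warpedMetric (gB : CovTensor IB B) (gF : CovTensor IF F) (ρ : B → ℝ) :
    CovTensor (IB.prod IF) (B × F) := fun z ↦
  pullback (IB.prod IF) IB Prod.fst z (gB z.1)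
    + (ρ z.1) ^ 2 • pullback (IB.prod IF) IF Prod.snd z (gF z.2)

variable {E : Type*} [NormedAddCommGroup E] [NormedSpace ℝ E]
  {H : Type*} [TopologicalSpace H] (I : ModelWithCorners ℝ E H)
  {M : Type*} [TopologicalSpace M] [ChartedSpace H M]

/-- `φ : B × F → M` exhibits the warped product `B ×_ρ F` of the pseudo-Riemannian manifolds
`(B, g_B)` and `(F, g_F)`, with `dim F > 0`, as a local warped product of `(M, g)` adapted to the
net `(D^⊥, D)`: `φ` is a diffeomorphism onto its open image and an isometry onto it, and maps the
slices `B × {y}` to integral manifolds of `D^⊥` and the slices `{b} × F` to integral manifolds of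
`D`. -/
structure IsAdaptedWarpedProduct [IsManifold IB ∞ B] [IsManifold IF ∞ F] (g : CovTensor I M)
    (D : Distribution I M) (gB : CovTensor IB B) (gF : CovTensor IF F) (ρ : B → ℝ)
    (φ : B × F → M) : Prop where
  metric_base : IsPseudoRiemannianMetric IB gB
  metric_fiber : IsPseudoRiemannianMetric IF gF
  fiber_dim_pos : 0 < Module.finrank ℝ EF
  warp_smooth : ContMDiff IB 𝓘(ℝ, ℝ) ∞ ρ
  warp_pos : ∀ b, 0 < ρ b
  injective : Function.Injective φ
  localDiffeo : IsLocalDiffeomorph (IB.prod IF) I ∞ φ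
  isometry : ∀ z : B × F,
    pullback (IB.prod IF) I φ z (g (φ z)) = warpedMetric IB IF gB gF ρ z
  adapted_base : ∀ (b : B) (y : F),
    (mfderiv IB I (fun b' : B ↦ φ (b', y)) b).range = orthogonal I g D (φ (b, y))
  adapted_fiber : ∀ (b : B) (y : F),
    (mfderiv IF I (fun y' : F ↦ φ (b, y')) y).range = D (φ (b, y))

end WarpedProducts

end WarpedKilling

end

noncomputable section

namespace WarpedKilling

/-! ### Vector-valued maps into spaces of linear maps -/

section FiniteDim

variable {E : Type*} [NormedAddCommGroup E] [NormedSpace ℝ E]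
  {H : Type*} [TopologicalSpace H] {I : ModelWithCorners ℝ E H}
  {M : Type*} [TopologicalSpace M] [ChartedSpace H M]
  {V W : Type*} [NormedAddCommGroup V] [NormedSpace ℝ V] [NormedAddCommGroup W] [NormedSpace ℝ W]

theorem contMDiffAt_finset_sum {ι : Type*} {n : WithTop ℕ∞} {x : M} (s : Finset ι)
    {f : ι → M → W} (hf : ∀ i, ContMDiffAt I 𝓘(ℝ, W) n (f i) x) :
    ContMDiffAt I 𝓘(ℝ, W) n (fun y ↦ ∑ i ∈ s, f i y) x := by
  classical
  induction s using Finset.induction_on with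
  | empty => simpa using contMDiffAt_const
  | insert i s hi ih =>
    simp only [Finset.sum_insert hi]
    exact (hf i).add ih

theorem contMDiffAt_of_forall_dual [FiniteDimensional ℝ W] {n : WithTop ℕ∞} {x : M} {f : M → W}
    (hf : ∀ p : W →L[ℝ] ℝ, ContMDiffAt I 𝓘(ℝ, ℝ) n (fun y ↦ p (f y)) x) :
    ContMDiffAt I 𝓘(ℝ, W) n f x := by
  let b := Module.finBasis ℝ W
  have h : f = fun y ↦ ∑ i, (LinearMap.toContinuousLinearMap (b.coord i) (f y)) • b i := by
    funext y
    exact (b.sum_repr (f y)).symm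
  rw [h]
  exact contMDiffAt_finset_sum _ fun i ↦ (hf _).smul contMDiffAt_const

theorem contMDiffAt_clm_of_apply [FiniteDimensional ℝ V] {n : WithTop ℕ∞} {x : M}
    {f : M → V →L[ℝ] W} (hf : ∀ v, ContMDiffAt I 𝓘(ℝ, W) n (fun y ↦ f y v) x) :
    ContMDiffAt I 𝓘(ℝ, V →L[ℝ] W) n f x := by
  let b := Module.finBasis ℝ V
  have h : f = fun y ↦ ∑ i, ContinuousLinearMap.smulRightL ℝ V W
      (LinearMap.toContinuousLinearMap (b.coord i)) (f y (b i)) := by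
    funext y
    ext v
    conv_lhs => rw [← b.sum_repr v]
    simp only [map_sum, map_smul, sum_apply]
    rfl
  rw [h]
  exact contMDiffAt_finset_sum _ fun i ↦
    ((ContinuousLinearMap.smulRightL ℝ V W _).contMDiff.contMDiffAt).comp x (hf (b i))

end FiniteDim

/-! ### Functions read in a chart -/

section Chart

variable {E : Type*} [NormedAddCommGroup E] [NormedSpace ℝ E]
  {H : Type*} [TopologicalSpace H] (I : ModelWithCorners ℝ E H)
  {M : Type*} [TopologicalSpace M] [ChartedSpace H M]

/-- The differential at `y` of the extended chart at `x₀`. -/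
def chartDiff (x₀ y : M) : TangentSpace I y →L[ℝ] E := mvfderiv I (extChartAt I x₀) y

/-- The derivative of `f` read in the extended chart at `x₀`. -/
def chartDeriv (x₀ : M) (f : M → ℝ) (y : M) : E →L[ℝ] ℝ :=
  fderiv ℝ (f ∘ (extChartAt I x₀).symm) (extChartAt I x₀ y)

variable {I}

theorem contDiffAt_comp_extChartAt_symm [I.Boundaryless] {W : Type*} [NormedAddCommGroup W]
    [NormedSpace ℝ W] {f : M → W} {x₀ : M}
    (hf : ContMDiffAt I 𝓘(ℝ, W) ∞ f x₀) :
    ContDiffAt ℝ ∞ (f ∘ (extChartAt I x₀).symm) (extChartAt I x₀ x₀) := by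
  have := (contMDiffAt_iff.1 hf).2
  simpa [I.range_eq_univ, contDiffWithinAt_univ] using! this

theorem contMDiffAt_chartDeriv [I.Boundaryless] {f : M → ℝ} {x₀ : M}
    (hf : ContMDiffAt I 𝓘(ℝ, ℝ) ∞ f x₀) :
    ContMDiffAt I 𝓘(ℝ, E →L[ℝ] ℝ) ∞ (chartDeriv I x₀ f) x₀ := by
  have h := (contDiffAt_comp_extChartAt_symm hf).fderiv_right (m := ∞) (by simp)
  exact h.contMDiffAt.comp x₀ contMDiffAt_extChartAt

variable [IsManifold I ∞ M]

theorem eventually_mdifferentiableAt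
    {E' : Type*} [NormedAddCommGroup E'] [NormedSpace ℝ E'] {H' : Type*} [TopologicalSpace H']
    {J : ModelWithCorners ℝ E' H'} {N : Type*} [TopologicalSpace N] [ChartedSpace H' N]
    [IsManifold J ∞ N] {f : M → N} {x : M} (hf : ContMDiffAt I J ∞ f x) :
    ∀ᶠ y in 𝓝 x, MDifferentiableAt I J f y := by
  have h1 : IsManifold I 1 M := .of_le (n := ∞) (by simp)
  have h2 : IsManifold J 1 N := .of_le (n := ∞) (by simp)
  filter_upwards [(contMDiffAt_iff_contMDiffAt_nhds (by simp)).1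
    (hf.of_le (by simp : (1 : WithTop ℕ∞) ≤ ∞))] with y hy
  exact hy.mdifferentiableAt one_ne_zero

theorem chartDiff_isInvertible {x₀ y : M} (hy : y ∈ (extChartAt I x₀).source) :
    ∃ A : TangentSpace I y ≃L[ℝ] E, (A : TangentSpace I y →L[ℝ] E) = chartDiff I x₀ y := by
  have h1 : IsManifold I 1 M := .of_le (n := ∞) (by simp)
  obtain ⟨A, hA⟩ := isInvertible_mfderiv_extChartAt (I := I) hy
  exact ⟨A, hA⟩

theorem contMDiffAt_chart_functional {x₀ y : M} (hy : y ∈ (extChartAt I x₀).source)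
    (p : E →L[ℝ] ℝ) : ContMDiffAt I 𝓘(ℝ, ℝ) ∞ (p ∘ extChartAt I x₀) y :=
  p.contMDiff.contMDiffAt.comp y (contMDiffAt_extChartAt' (by simpa using hy))

theorem mvfderiv_chart_functional {x₀ y : M} (hy : y ∈ (extChartAt I x₀).source)
    (p : E →L[ℝ] ℝ) : mvfderiv I (p ∘ extChartAt I x₀) y = p ∘L chartDiff I x₀ y := by
  have h1 : IsManifold I 1 M := .of_le (n := ∞) (by simp)
  have hc := mfderiv_comp y p.mdifferentiableAt
    (mdifferentiableAt_extChartAt (I := I) (x := x₀) (y := y) (by simpa using hy))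
  rw [p.mfderiv_eq] at hc
  exact hc

/-- Every covector is the differential of a function. -/
theorem exists_mvfderiv_eq (x : M) (q : TangentSpace I x →L[ℝ] ℝ) :
    ∃ f : M → ℝ, ContMDiffAt I 𝓘(ℝ, ℝ) ∞ f x ∧ mvfderiv I f x = q := by
  obtain ⟨A, hA⟩ := chartDiff_isInvertible (I := I) (mem_extChartAt_source (I := I) x)
  refine ⟨(q ∘L (A.symm : E →L[ℝ] TangentSpace I x)) ∘ extChartAt I x,
    contMDiffAt_chart_functional (mem_extChartAt_source x) _, ?_⟩
  rw [mvfderiv_chart_functional (mem_extChartAt_source x), ← hA]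
  ext v
  simp

variable [I.Boundaryless]

theorem mvfderiv_eventuallyEq_chartDeriv {f : M → ℝ} {x₀ : M}
    (hf : ContMDiffAt I 𝓘(ℝ, ℝ) ∞ f x₀) :
    ∀ᶠ y in 𝓝 x₀, mvfderiv I f y = (chartDeriv I x₀ f y) ∘L (chartDiff I x₀ y) := by
  have h1 : IsManifold I 1 M := .of_le (n := ∞) (by simp)
  have hd : ∀ᶠ y in 𝓝 x₀, DifferentiableAt ℝ (f ∘ (extChartAt I x₀).symm) (extChartAt I x₀ y) := by
    have h2 : ∀ᶠ e in 𝓝 (extChartAt I x₀ x₀),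
        DifferentiableAt ℝ (f ∘ (extChartAt I x₀).symm) e := by
      filter_upwards [((contDiffAt_comp_extChartAt_symm hf).of_le
        (by simp : (1 : WithTop ℕ∞) ≤ ∞)).eventually (by simp)] with e he
      exact he.differentiableAt one_ne_zero
    exact (continuousAt_extChartAt x₀).eventually h2
  filter_upwards [hd, eventually_eventually_nhds.2 (extChartAt_source_mem_nhds (I := I) x₀)]
    with y hy hys
  have hy' : y ∈ (chartAt H x₀).source := by
    rw [← extChartAt_source I]
    exact hys.self_of_nhds
  have hfy : f =ᶠ[𝓝 y] (f ∘ (extChartAt I x₀).symm) ∘ (extChartAt I x₀) := by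
    filter_upwards [hys] with z hz
    exact congrArg f ((extChartAt I x₀).left_inv hz).symm
  have hm : mfderiv I 𝓘(ℝ, ℝ) f y =
      mfderiv I 𝓘(ℝ, ℝ) ((f ∘ (extChartAt I x₀).symm) ∘ (extChartAt I x₀)) y := hfy.mfderiv_eq
  have hc := mfderiv_comp y hy.mdifferentiableAt (mdifferentiableAt_extChartAt (I := I) hy')
  rw [hc, mfderiv_eq_fderiv] at hm
  exact hm

end Chart

/-! ### Contractions and the Schouten bracket -/

section Schouten

variable {E : Type*} [NormedAddCommGroup E] [NormedSpace ℝ E]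
  {H : Type*} [TopologicalSpace H] (I : ModelWithCorners ℝ E H)
  {M : Type*} [TopologicalSpace M] [ChartedSpace H M]

/-- The function `T(df, dh)`. -/
def contraction (T : ContraTensor I M) (f h : M → ℝ) : M → ℝ :=
  fun y ↦ mvfderiv I f y (T y (mvfderiv I h y))

/-- One of the three terms in the cyclic sum defining the Schouten bracket. -/
def schoutenTerm (K G : ContraTensor I M) (u f h : M → ℝ) (x : M) : ℝ :=
  mvfderiv I (contraction I G f h) x (K x (mvfderiv I u x))
    - mvfderiv I (contraction I K f h) x (G x (mvfderiv I u x))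

/-- The tensor field `T` read in the extended chart at `x₀`. -/
def tensorInChart (T : ContraTensor I M) (x₀ y : M) : (E →L[ℝ] ℝ) →L[ℝ] E :=
  (chartDiff I x₀ y) ∘L (T y) ∘L (ContinuousLinearMap.precomp ℝ (chartDiff I x₀ y))

variable {I}

theorem schouten_eq (K G : ContraTensor I M) (f₁ f₂ f₃ : M → ℝ) (x : M) :
    schouten I K G f₁ f₂ f₃ x = (2 / 3 : ℝ) * (schoutenTerm I K G f₁ f₂ f₃ x
      + schoutenTerm I K G f₂ f₃ f₁ x + schoutenTerm I K G f₃ f₁ f₂ x) := rfl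

theorem IsSymmetricTensorField.contMDiffAt {T : ContraTensor I M}
    (hT : IsSymmetricTensorField I T) {x : M} {f h : M → ℝ}
    (hf : ContMDiffAt I 𝓘(ℝ, ℝ) ∞ f x) (hh : ContMDiffAt I 𝓘(ℝ, ℝ) ∞ h x) :
    ContMDiffAt I 𝓘(ℝ, ℝ) ∞ (contraction I T f h) x :=
  hT.smooth x f h hf hh

theorem IsSymmetricTensorField.mdifferentiableAt {T : ContraTensor I M}
    (hT : IsSymmetricTensorField I T) {x : M} {f h : M → ℝ}
    (hf : ContMDiffAt I 𝓘(ℝ, ℝ) ∞ f x) (hh : ContMDiffAt I 𝓘(ℝ, ℝ) ∞ h x) :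
    MDifferentiableAt I 𝓘(ℝ, ℝ) (contraction I T f h) x :=
  (hT.contMDiffAt hf hh).mdifferentiableAt (by simp)

theorem contraction_comm {T : ContraTensor I M}
    (hT : ∀ (x : M) (p q : TangentSpace I x →L[ℝ] ℝ), p (T x q) = q (T x p)) (f h : M → ℝ) :
    contraction I T f h = contraction I T h f :=
  funext fun y ↦ hT y _ _

variable [IsManifold I ∞ M]

theorem tensorInChart_apply (T : ContraTensor I M) {x₀ y : M} (hy : y ∈ (extChartAt I x₀).source)
    (p q : E →L[ℝ] ℝ) :
    p (tensorInChart I T x₀ y q) =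
      contraction I T (p ∘ extChartAt I x₀) (q ∘ extChartAt I x₀) y := by
  rw [contraction, mvfderiv_chart_functional hy, mvfderiv_chart_functional hy]
  rfl

theorem contMDiffAt_tensorInChart [FiniteDimensional ℝ E] {T : ContraTensor I M} {x₀ : M}
    (hT : ∀ p q : E →L[ℝ] ℝ, ContMDiffAt I 𝓘(ℝ, ℝ) ∞
      (contraction I T (p ∘ extChartAt I x₀) (q ∘ extChartAt I x₀)) x₀) :
    ContMDiffAt I 𝓘(ℝ, (E →L[ℝ] ℝ) →L[ℝ] E) ∞ (tensorInChart I T x₀) x₀ := by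
  refine contMDiffAt_clm_of_apply fun q ↦ contMDiffAt_of_forall_dual fun p ↦
    (hT p q).congr_of_eventuallyEq ?_
  filter_upwards [extChartAt_source_mem_nhds (I := I) x₀] with y hy
  exact tensorInChart_apply T hy p q

theorem IsSymmetricTensorField.contMDiffAt_tensorInChart [FiniteDimensional ℝ E]
    {T : ContraTensor I M} (hT : IsSymmetricTensorField I T) (x₀ : M) :
    ContMDiffAt I 𝓘(ℝ, (E →L[ℝ] ℝ) →L[ℝ] E) ∞ (tensorInChart I T x₀) x₀ :=
  WarpedKilling.contMDiffAt_tensorInChart fun p q ↦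
    hT.contMDiffAt (contMDiffAt_chart_functional (mem_extChartAt_source x₀) p)
      (contMDiffAt_chart_functional (mem_extChartAt_source x₀) q)

variable [I.Boundaryless]

theorem contraction_eventuallyEq (T : ContraTensor I M) {x₀ : M} {f h : M → ℝ}
    (hf : ContMDiffAt I 𝓘(ℝ, ℝ) ∞ f x₀) (hh : ContMDiffAt I 𝓘(ℝ, ℝ) ∞ h x₀) :
    contraction I T f h =ᶠ[𝓝 x₀]
      fun y ↦ chartDeriv I x₀ f y (tensorInChart I T x₀ y (chartDeriv I x₀ h y)) := by
  filter_upwards [mvfderiv_eventuallyEq_chartDeriv hf, mvfderiv_eventuallyEq_chartDeriv hh]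
    with y hfy hhy
  rw [contraction, hfy, hhy]
  rfl

/-- Smoothness of a contravariant tensor field may be tested on coordinate functions. -/
theorem contMDiffAt_contraction_of_chart [FiniteDimensional ℝ E] {T : ContraTensor I M} {x₀ : M}
    (hT : ∀ p q : E →L[ℝ] ℝ, ContMDiffAt I 𝓘(ℝ, ℝ) ∞
      (contraction I T (p ∘ extChartAt I x₀) (q ∘ extChartAt I x₀)) x₀) {f h : M → ℝ}
    (hf : ContMDiffAt I 𝓘(ℝ, ℝ) ∞ f x₀) (hh : ContMDiffAt I 𝓘(ℝ, ℝ) ∞ h x₀) :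
    ContMDiffAt I 𝓘(ℝ, ℝ) ∞ (contraction I T f h) x₀ :=
  ((contMDiffAt_chartDeriv hf).clm_apply
    ((contMDiffAt_tensorInChart hT).clm_apply (contMDiffAt_chartDeriv hh))).congr_of_eventuallyEq
      (contraction_eventuallyEq T hf hh)

/-- At a critical point of `f`, the differential of `T(df, dh)` is given by the Hessian of `f`. -/
theorem exists_hessian [FiniteDimensional ℝ E] {x : M} {f : M → ℝ}
    (hf : ContMDiffAt I 𝓘(ℝ, ℝ) ∞ f x) (hf0 : mvfderiv I f x = 0) :
    ∃ Q : TangentSpace I x → TangentSpace I x → ℝ, (∀ v w, Q v w = Q w v) ∧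
      ∀ T : ContraTensor I M, IsSymmetricTensorField I T → ∀ h : M → ℝ,
        ContMDiffAt I 𝓘(ℝ, ℝ) ∞ h x → ∀ v,
          mvfderiv I (contraction I T f h) x v = Q v (T x (mvfderiv I h x)) := by
  set e := extChartAt I x x with he
  set f' := f ∘ (extChartAt I x).symm with hf'
  have hfd : ContDiffAt ℝ ∞ f' e := contDiffAt_comp_extChartAt_symm hf
  refine ⟨fun v w ↦ fderiv ℝ (fderiv ℝ f') e (chartDiff I x x v) (chartDiff I x x w), ?_, ?_⟩
  · intro v w
    exact (hfd.isSymmSndFDerivAt (by simpa using! (WithTop.coe_le_coe.2 le_top : ((2 : ℕ∞) : WithTop ℕ∞) ≤ ∞))) _ _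
  · intro T hT h hh v
    set S : M → E := fun y ↦ tensorInChart I T x y (chartDeriv I x h y) with hS
    have hSs : ContMDiffAt I 𝓘(ℝ, E) ∞ S x :=
      (hT.contMDiffAt_tensorInChart x).clm_apply (contMDiffAt_chartDeriv hh)
    have hSd : ContDiffAt ℝ ∞ (S ∘ (extChartAt I x).symm) e := contDiffAt_comp_extChartAt_symm hSs
    have h0 : fderiv ℝ f' e = 0 := by
      have h1 := (mvfderiv_eventuallyEq_chartDeriv hf).self_of_nhds
      obtain ⟨A, hA⟩ := chartDiff_isInvertible (I := I) (mem_extChartAt_source (I := I) x)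
      rw [hf0, ← hA] at h1
      ext w
      have h2 := congrArg (fun q : TangentSpace I x →L[ℝ] ℝ ↦ q (A.symm w)) h1
      simpa [chartDeriv] using! h2.symm
    have hev : (contraction I T f h) ∘ (extChartAt I x).symm =ᶠ[𝓝 e]
        fun e' ↦ fderiv ℝ f' e' ((S ∘ (extChartAt I x).symm) e') := by
      have hc : Filter.Tendsto (extChartAt I x).symm (𝓝 e) (𝓝 x) := by
        have := (continuousAt_extChartAt_symm (I := I) x).tendsto
        rwa [extChartAt_to_inv] at this
      filter_upwards [hc.eventually (contraction_eventuallyEq T hf hh),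
        extChartAt_target_mem_nhds (I := I) x] with e' h2 h3
      refine h2.trans ?_
      simp only [chartDeriv, Function.comp_apply, hS, (extChartAt I x).right_inv h3, hf']
    have hder := ((hfd.fderiv_right (m := ∞) (by simp)).differentiableAt
      (by simp)).hasFDerivAt.clm_apply (hSd.differentiableAt (by simp)).hasFDerivAt
    rw [(mvfderiv_eventuallyEq_chartDeriv (hT.contMDiffAt hf hh)).self_of_nhds]
    have h3 : chartDeriv I x (contraction I T f h) x = _ := hev.fderiv_eq.trans hder.fderiv
    have h4 : S x = chartDiff I x x (T x (mvfderiv I h x)) := by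
      rw [(mvfderiv_eventuallyEq_chartDeriv hh).self_of_nhds]
      rfl
    rw [h3, h0]
    simp [h4, he]

end Schouten

section Tensorial

variable {E : Type*} [NormedAddCommGroup E] [NormedSpace ℝ E]
  {H : Type*} [TopologicalSpace H] {I : ModelWithCorners ℝ E H}
  {M : Type*} [TopologicalSpace M] [ChartedSpace H M]

/-! ### Tensoriality of the Schouten bracket -/

theorem schouten_cycle (K G : ContraTensor I M) (f₁ f₂ f₃ : M → ℝ) (x : M) :
    schouten I K G f₁ f₂ f₃ x = schouten I K G f₂ f₃ f₁ x := by
  rw [schouten_eq, schouten_eq]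
  ring

theorem mvfderiv_congr {f h : M → ℝ} {x : M} (hfh : f =ᶠ[𝓝 x] h) :
    mvfderiv I f x = mvfderiv I h x := by
  have h1 : mfderiv I 𝓘(ℝ, ℝ) f x = mfderiv I 𝓘(ℝ, ℝ) h x := hfh.mfderiv_eq
  exact h1

variable [IsManifold I ∞ M]

theorem contraction_add_left (T : ContraTensor I M) {x : M} {f f' : M → ℝ} (h : M → ℝ)
    (hf : ContMDiffAt I 𝓘(ℝ, ℝ) ∞ f x) (hf' : ContMDiffAt I 𝓘(ℝ, ℝ) ∞ f' x) :
    contraction I T (f + f') h =ᶠ[𝓝 x] contraction I T f h + contraction I T f' h := by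
  filter_upwards [eventually_mdifferentiableAt hf, eventually_mdifferentiableAt hf'] with y h1 h2
  simp [contraction, mvfderiv_add h1 h2]

theorem mvfderiv_contraction_add_left {T : ContraTensor I M} (hT : IsSymmetricTensorField I T)
    {x : M} {f f' h : M → ℝ} (hf : ContMDiffAt I 𝓘(ℝ, ℝ) ∞ f x)
    (hf' : ContMDiffAt I 𝓘(ℝ, ℝ) ∞ f' x) (hh : ContMDiffAt I 𝓘(ℝ, ℝ) ∞ h x) :
    mvfderiv I (contraction I T (f + f') h) x =
      mvfderiv I (contraction I T f h) x + mvfderiv I (contraction I T f' h) x := by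
  rw [mvfderiv_congr (contraction_add_left T h hf hf'),
    mvfderiv_add (hT.mdifferentiableAt hf hh) (hT.mdifferentiableAt hf' hh)]

theorem schouten_add_left {K G : ContraTensor I M} (hK : IsSymmetricTensorField I K)
    (hG : IsSymmetricTensorField I G) {x : M} {f f' f₂ f₃ : M → ℝ}
    (hf : ContMDiffAt I 𝓘(ℝ, ℝ) ∞ f x) (hf' : ContMDiffAt I 𝓘(ℝ, ℝ) ∞ f' x)
    (hf₂ : ContMDiffAt I 𝓘(ℝ, ℝ) ∞ f₂ x) (hf₃ : ContMDiffAt I 𝓘(ℝ, ℝ) ∞ f₃ x) :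
    schouten I K G (f + f') f₂ f₃ x = schouten I K G f f₂ f₃ x + schouten I K G f' f₂ f₃ x := by
  simp only [schouten_eq, schoutenTerm]
  rw [contraction_comm hK.symm f₃ (f + f'), contraction_comm hG.symm f₃ (f + f'),
    contraction_comm hK.symm f₃ f, contraction_comm hG.symm f₃ f,
    contraction_comm hK.symm f₃ f', contraction_comm hG.symm f₃ f',
    mvfderiv_contraction_add_left hK hf hf' hf₂, mvfderiv_contraction_add_left hK hf hf' hf₃,
    mvfderiv_contraction_add_left hG hf hf' hf₂, mvfderiv_contraction_add_left hG hf hf' hf₃,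
    mvfderiv_add (hf.mdifferentiableAt (by simp)) (hf'.mdifferentiableAt (by simp))]
  simp only [map_add, add_apply]
  ring

variable [I.Boundaryless] [FiniteDimensional ℝ E]

theorem schouten_eq_zero_of_mvfderiv_eq_zero {K G : ContraTensor I M}
    (hK : IsSymmetricTensorField I K) (hG : IsSymmetricTensorField I G) {x : M}
    {f₁ f₂ f₃ : M → ℝ} (hf₁ : ContMDiffAt I 𝓘(ℝ, ℝ) ∞ f₁ x)
    (hf₂ : ContMDiffAt I 𝓘(ℝ, ℝ) ∞ f₂ x) (hf₃ : ContMDiffAt I 𝓘(ℝ, ℝ) ∞ f₃ x)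
    (h0 : mvfderiv I f₁ x = 0) : schouten I K G f₁ f₂ f₃ x = 0 := by
  obtain ⟨Q, hQ, h⟩ := exists_hessian hf₁ h0
  simp only [schouten_eq, schoutenTerm]
  rw [contraction_comm hK.symm f₃ f₁, contraction_comm hG.symm f₃ f₁, h K hK f₂ hf₂, h G hG f₂ hf₂,
    h K hK f₃ hf₃, h G hG f₃ hf₃, h0, hQ (K x (mvfderiv I f₂ x)) _,
    hQ (G x (mvfderiv I f₂ x)) _]
  simp

/-- The Schouten bracket depends on its arguments only through their differentials. -/
theorem schouten_congr_left {K G : ContraTensor I M}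
    (hK : IsSymmetricTensorField I K) (hG : IsSymmetricTensorField I G) {x : M}
    {f f' f₂ f₃ : M → ℝ} (hf : ContMDiffAt I 𝓘(ℝ, ℝ) ∞ f x) (hf' : ContMDiffAt I 𝓘(ℝ, ℝ) ∞ f' x)
    (hf₂ : ContMDiffAt I 𝓘(ℝ, ℝ) ∞ f₂ x) (hf₃ : ContMDiffAt I 𝓘(ℝ, ℝ) ∞ f₃ x)
    (h : mvfderiv I f x = mvfderiv I f' x) :
    schouten I K G f f₂ f₃ x = schouten I K G f' f₂ f₃ x := by
  have hs : ContMDiffAt I 𝓘(ℝ, ℝ) ∞ (f - f') x := hf.sub hf'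
  have h0 : mvfderiv I (f - f') x = 0 := by
    rw [mvfderiv_sub (hf.mdifferentiableAt (by simp)) (hf'.mdifferentiableAt (by simp)), h, sub_self]
  have := schouten_add_left hK hG hf' hs hf₂ hf₃
  rw [schouten_eq_zero_of_mvfderiv_eq_zero hK hG hs hf₂ hf₃ h0, add_sub_cancel, add_zero] at this
  exact this

end Tensorial

/-! ### Naturality -/

section Naturality

variable {E : Type*} [NormedAddCommGroup E] [NormedSpace ℝ E]
  {H : Type*} [TopologicalSpace H] {I : ModelWithCorners ℝ E H}
  {N : Type*} [TopologicalSpace N] [ChartedSpace H N]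
  {E' : Type*} [NormedAddCommGroup E'] [NormedSpace ℝ E']
  {H' : Type*} [TopologicalSpace H'] {J : ModelWithCorners ℝ E' H'}
  {M : Type*} [TopologicalSpace M] [ChartedSpace H' M]

theorem contraction_pushforward {φ : N → M} {T : ContraTensor I N} {S : ContraTensor J M} {z : N}
    (hTS : S (φ z) = pushforward I J φ z (T z)) (hφ : MDifferentiableAt I J φ z) {f h : M → ℝ}
    (hf : MDifferentiableAt J 𝓘(ℝ, ℝ) f (φ z)) (hh : MDifferentiableAt J 𝓘(ℝ, ℝ) h (φ z)) :
    contraction J S f h (φ z) = contraction I T (f ∘ φ) (h ∘ φ) z := by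
  rw [contraction, contraction, mvfderiv_comp z hf hφ, mvfderiv_comp z hh hφ, hTS]
  rfl

variable [IsManifold I ∞ N] [IsManifold J ∞ M]

theorem contraction_comp_eventuallyEq {φ : N → M} {T : ContraTensor I N} {S : ContraTensor J M}
    {z : N} (hTS : ∀ z, S (φ z) = pushforward I J φ z (T z)) (hφ : ContMDiffAt I J ∞ φ z)
    {f h : M → ℝ} (hf : ContMDiffAt J 𝓘(ℝ, ℝ) ∞ f (φ z)) (hh : ContMDiffAt J 𝓘(ℝ, ℝ) ∞ h (φ z)) :
    contraction J S f h ∘ φ =ᶠ[𝓝 z] contraction I T (f ∘ φ) (h ∘ φ) := by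
  filter_upwards [eventually_mdifferentiableAt hφ,
    hφ.continuousAt.eventually (eventually_mdifferentiableAt hf),
    hφ.continuousAt.eventually (eventually_mdifferentiableAt hh)] with y h1 h2 h3
  exact contraction_pushforward (hTS y) h1 h2 h3

theorem schoutenTerm_pushforward {φ : N → M} {K G : ContraTensor I N} {K' G' : ContraTensor J M}
    {z : N} (hK : ∀ z, K' (φ z) = pushforward I J φ z (K z))
    (hG : ∀ z, G' (φ z) = pushforward I J φ z (G z)) (hφ : ContMDiffAt I J ∞ φ z)
    (hK' : IsSymmetricTensorField J K') (hG' : IsSymmetricTensorField J G')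
    {u f h : M → ℝ} (hu : ContMDiffAt J 𝓘(ℝ, ℝ) ∞ u (φ z))
    (hf : ContMDiffAt J 𝓘(ℝ, ℝ) ∞ f (φ z)) (hh : ContMDiffAt J 𝓘(ℝ, ℝ) ∞ h (φ z)) :
    schoutenTerm J K' G' u f h (φ z) = schoutenTerm I K G (u ∘ φ) (f ∘ φ) (h ∘ φ) z := by
  have hφd : MDifferentiableAt I J φ z := hφ.mdifferentiableAt (by simp)
  rw [schoutenTerm, schoutenTerm, ← mvfderiv_congr (contraction_comp_eventuallyEq hK hφ hf hh),
    ← mvfderiv_congr (contraction_comp_eventuallyEq hG hφ hf hh),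
    mvfderiv_comp z (hK'.mdifferentiableAt hf hh) hφd,
    mvfderiv_comp z (hG'.mdifferentiableAt hf hh) hφd,
    mvfderiv_comp z (hu.mdifferentiableAt (by simp)) hφd, hK, hG]
  rfl

/-- The Schouten bracket is natural. -/
theorem schouten_pushforward {φ : N → M} {K G : ContraTensor I N} {K' G' : ContraTensor J M}
    {z : N} (hK : ∀ z, K' (φ z) = pushforward I J φ z (K z))
    (hG : ∀ z, G' (φ z) = pushforward I J φ z (G z)) (hφ : ContMDiffAt I J ∞ φ z)
    (hK' : IsSymmetricTensorField J K') (hG' : IsSymmetricTensorField J G')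
    {f₁ f₂ f₃ : M → ℝ} (hf₁ : ContMDiffAt J 𝓘(ℝ, ℝ) ∞ f₁ (φ z))
    (hf₂ : ContMDiffAt J 𝓘(ℝ, ℝ) ∞ f₂ (φ z)) (hf₃ : ContMDiffAt J 𝓘(ℝ, ℝ) ∞ f₃ (φ z)) :
    schouten J K' G' f₁ f₂ f₃ (φ z) = schouten I K G (f₁ ∘ φ) (f₂ ∘ φ) (f₃ ∘ φ) z := by
  rw [schouten_eq, schouten_eq, schoutenTerm_pushforward hK hG hφ hK' hG' hf₁ hf₂ hf₃,
    schoutenTerm_pushforward hK hG hφ hK' hG' hf₂ hf₃ hf₁,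
    schoutenTerm_pushforward hK hG hφ hK' hG' hf₃ hf₁ hf₂]

end Naturality

/-! ### Functions with vanishing differential -/

section Constant

variable {E : Type*} [NormedAddCommGroup E] [NormedSpace ℝ E]
  {H : Type*} [TopologicalSpace H] {I : ModelWithCorners ℝ E H} [I.Boundaryless]
  {M : Type*} [TopologicalSpace M] [ChartedSpace H M] [IsManifold I ∞ M] [ConnectedSpace M]

theorem eq_of_mvfderiv_eq_zero {f : M → ℝ} (hf : MDifferentiable I 𝓘(ℝ, ℝ) f)
    (h0 : ∀ x, mvfderiv I f x = 0) (x y : M) : f x = f y := by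
  have h1 : IsManifold I 1 M := .of_le (n := ∞) (by simp)
  refine IsLocallyConstant.apply_eq_of_preconnectedSpace
    ((IsLocallyConstant.iff_eventually_eq f).2 fun x₀ ↦ ?_) x y
  obtain ⟨r, hr, hball⟩ := Metric.mem_nhds_iff.1 (extChartAt_target_mem_nhds (I := I) x₀)
  have hd : ∀ e ∈ Metric.ball (extChartAt I x₀ x₀) r,
      HasFDerivAt (f ∘ (extChartAt I x₀).symm) (0 : E →L[ℝ] ℝ) e := by
    intro e he
    have hs : MDifferentiableAt 𝓘(ℝ, E) I (extChartAt I x₀).symm e := by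
      have := mdifferentiableWithinAt_extChartAt_symm (I := I) (hball he)
      rwa [I.range_eq_univ, mdifferentiableWithinAt_univ] at this
    have hc : MDifferentiableAt 𝓘(ℝ, E) 𝓘(ℝ, ℝ) (f ∘ (extChartAt I x₀).symm) e :=
      (hf _).comp e hs
    have h2 := mvfderiv_comp e (hf _) hs
    rw [h0, ContinuousLinearMap.zero_comp] at h2
    have h3 : fderiv ℝ (f ∘ (extChartAt I x₀).symm) e = 0 := by
      rw [← mfderiv_eq_fderiv]
      exact h2
    rw [← h3]
    exact hc.differentiableAt.hasFDerivAt
  have hconst : ∀ e ∈ Metric.ball (extChartAt I x₀ x₀) r,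
      (f ∘ (extChartAt I x₀).symm) e = (f ∘ (extChartAt I x₀).symm) (extChartAt I x₀ x₀) :=
    fun e he ↦ Metric.isOpen_ball.is_const_of_fderiv_eq_zero
      (convex_ball _ _).isPreconnected
      (fun e he ↦ (hd e he).differentiableAt.differentiableWithinAt)
      (fun e he ↦ (hd e he).fderiv) he (Metric.mem_ball_self hr)
  filter_upwards [extChartAt_source_mem_nhds (I := I) x₀,
    (continuousAt_extChartAt (I := I) x₀).eventually (Metric.ball_mem_nhds _ hr)] with z hz hz'
  have := hconst _ hz'
  simpa only [Function.comp_apply, (extChartAt I x₀).left_inv hz, extChartAt_to_inv] using this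

end Constant

/-! ### The contravariant metric -/

section Cometric

theorem isInvertible_of_nondegenerate {V : Type*} [NormedAddCommGroup V] [NormedSpace ℝ V]
    [FiniteDimensional ℝ V] (B : V →L[ℝ] V →L[ℝ] ℝ) (hB : ∀ v, (∀ w, B v w = 0) → v = 0) :
    B.IsInvertible := by
  have hinj : Function.Injective (B : V →ₗ[ℝ] V →L[ℝ] ℝ) := by
    refine (injective_iff_map_eq_zero _).2 fun v hv ↦ hB v fun w ↦ ?_
    exact congrArg (fun q : V →L[ℝ] ℝ ↦ q w) hv
  have hdim : Module.finrank ℝ V = Module.finrank ℝ (V →L[ℝ] ℝ) := by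
    rw [← Subspace.dual_finrank_eq]
    exact (LinearMap.toContinuousLinearMap : (V →ₗ[ℝ] ℝ) ≃ₗ[ℝ] (V →L[ℝ] ℝ)).finrank_eq
  refine ⟨(LinearEquiv.ofInjectiveOfFinrankEq (B : V →ₗ[ℝ] V →L[ℝ] ℝ) hinj
    hdim).toContinuousLinearEquiv, ?_⟩
  ext v w
  rfl

variable {E : Type*} [NormedAddCommGroup E] [NormedSpace ℝ E] [FiniteDimensional ℝ E]
  {H : Type*} [TopologicalSpace H] {I : ModelWithCorners ℝ E H}
  {M : Type*} [TopologicalSpace M] [ChartedSpace H M] [IsManifold I ∞ M]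
  {g : CovTensor I M}

theorem IsPseudoRiemannianMetric.isInvertible (hg : IsPseudoRiemannianMetric I g) (x : M) :
    (g x).IsInvertible :=
  isInvertible_of_nondegenerate (V := E) (g x) (hg.nondegenerate x)

theorem IsPseudoRiemannianMetric.cometric_apply (hg : IsPseudoRiemannianMetric I g) (x : M)
    (v : TangentSpace I x) : cometric I g x (g x v) = v :=
  (hg.isInvertible x).inverse_apply_self v

theorem IsPseudoRiemannianMetric.apply_cometric (hg : IsPseudoRiemannianMetric I g) (x : M)
    (p : TangentSpace I x →L[ℝ] ℝ) : g x (cometric I g x p) = p :=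
  (hg.isInvertible x).self_apply_inverse p

theorem IsPseudoRiemannianMetric.cometric_symm (hg : IsPseudoRiemannianMetric I g) (x : M)
    (p q : TangentSpace I x →L[ℝ] ℝ) : p (cometric I g x q) = q (cometric I g x p) := by
  conv_lhs => rw [← hg.apply_cometric x p]
  conv_rhs => rw [← hg.apply_cometric x q]
  exact hg.symm x _ _

theorem IsPseudoRiemannianMetric.contMDiffAt_tensorInChart_cometric
    (hg : IsPseudoRiemannianMetric I g) (x₀ : M) :
    ContMDiffAt I 𝓘(ℝ, (E →L[ℝ] ℝ) →L[ℝ] E) ∞ (tensorInChart I (cometric I g) x₀) x₀ := by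
  have h1 : IsManifold I 1 M := .of_le (n := ∞) (by simp)
  let e := trivializationAt E (TangentSpace I) x₀
  let S : ∀ y : M, E →L[ℝ] TangentSpace I y := fun y ↦ e.symmL ℝ y
  have hx₀ : x₀ ∈ e.baseSet := FiberBundle.mem_baseSet_trivializationAt' x₀
  have hS : ∀ v : E, ContMDiffAt I (I.prod 𝓘(ℝ, E)) ∞
      (fun y ↦ (Bundle.TotalSpace.mk' E y (S y v) : TangentBundle I M)) x₀ := by
    intro v
    rw [Bundle.contMDiffAt_section]
    refine (contMDiffAt_const (c := v)).congr_of_eventuallyEq ?_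
    filter_upwards [e.open_baseSet.mem_nhds hx₀] with y hy
    change (e ⟨y, e.symmL ℝ y v⟩).2 = v
    rw [e.symmL_apply hy, e.apply_mk_symm hy]
  let gC : M → E →L[ℝ] E →L[ℝ] ℝ :=
    fun y ↦ (ContinuousLinearMap.precomp ℝ (S y)) ∘L (g y) ∘L (S y)
  have hgC : ContMDiffAt I 𝓘(ℝ, E →L[ℝ] E →L[ℝ] ℝ) ∞ gC x₀ := by
    refine contMDiffAt_clm_of_apply fun v ↦ contMDiffAt_clm_of_apply fun w ↦ ?_
    have h2 : ContMDiffAt I (I.prod 𝓘(ℝ, ℝ)) ∞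
        (fun y ↦ Bundle.TotalSpace.mk' ℝ (E := Bundle.Trivial M ℝ) y (g y (S y v) (S y w))) x₀ := by
      apply ContMDiffAt.clm_bundle_apply₂ (F₁ := E) (F₂ := E)
      · exact hg.smooth x₀
      · exact hS v
      · exact hS w
    rw [Bundle.contMDiffAt_totalSpace] at h2
    exact h2.2
  have hinv : ∀ y ∈ e.baseSet, tensorInChart I (cometric I g) x₀ y = (gC y).inverse ∧
      (gC y).IsInvertible := by
    intro y hy
    have hys : y ∈ (chartAt H x₀).source := hy
    have hA : chartDiff I x₀ y = e.continuousLinearMapAt ℝ y :=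
      (TangentBundle.continuousLinearMapAt_trivializationAt hys).symm
    have hAS : ∀ v : E, chartDiff I x₀ y (S y v) = v := by
      intro v
      rw [hA]
      exact e.continuousLinearMapAt_symmL hy v
    have hSA : ∀ v : TangentSpace I y, S y (chartDiff I x₀ y v) = v := by
      intro v
      rw [hA]
      exact e.symmL_continuousLinearMapAt hy v
    have hl : gC y ∘L tensorInChart I (cometric I g) x₀ y = ContinuousLinearMap.id ℝ _ := by
      ext q v
      change g y (S y (chartDiff I x₀ y (cometric I g y (q ∘L chartDiff I x₀ y)))) (S y v) = q v
      rw [hSA, hg.apply_cometric]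
      exact congrArg q (hAS v)
    have hr : tensorInChart I (cometric I g) x₀ y ∘L gC y = ContinuousLinearMap.id ℝ _ := by
      ext v
      have h3 : (g y (S y v) ∘L S y) ∘L chartDiff I x₀ y = g y (S y v) := by
        ext w
        exact congrArg (g y (S y v)) (hSA w)
      change chartDiff I x₀ y (cometric I g y ((g y (S y v) ∘L S y) ∘L chartDiff I x₀ y)) = v
      rw [h3, hg.cometric_apply, hAS]
    exact ⟨(ContinuousLinearMap.inverse_eq hl hr).symm, .of_inverse hl hr⟩
  have h4 : ContMDiffAt I 𝓘(ℝ, (E →L[ℝ] ℝ) →L[ℝ] E) ∞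
      (ContinuousLinearMap.inverse ∘ gC) x₀ :=
    ((hinv x₀ hx₀).2.contDiffAt_map_inverse.contMDiffAt).comp x₀ hgC
  refine h4.congr_of_eventuallyEq ?_
  filter_upwards [e.open_baseSet.mem_nhds hx₀] with y hy
  exact (hinv y hy).1

theorem IsPseudoRiemannianMetric.isSymmetricTensorField_cometric [I.Boundaryless]
    (hg : IsPseudoRiemannianMetric I g) : IsSymmetricTensorField I (cometric I g) where
  symm := hg.cometric_symm
  smooth x _ _ hf hh :=
    ((contMDiffAt_chartDeriv hf).clm_apply ((hg.contMDiffAt_tensorInChart_cometric x).clm_apply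
      (contMDiffAt_chartDeriv hh))).congr_of_eventuallyEq (contraction_eventuallyEq _ hf hh)

end Cometric

/-! ### Tensor fields on a product -/

section Product

variable {EB : Type*} [NormedAddCommGroup EB] [NormedSpace ℝ EB]
  {HB : Type*} [TopologicalSpace HB] {IB : ModelWithCorners ℝ EB HB}
  {B : Type*} [TopologicalSpace B] [ChartedSpace HB B]
  {EF : Type*} [NormedAddCommGroup EF] [NormedSpace ℝ EF]
  {HF : Type*} [TopologicalSpace HF] {IF : ModelWithCorners ℝ EF HF}
  {F : Type*} [TopologicalSpace F] [ChartedSpace HF F]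

/-- The component of `T` along `B`, restricted to the slice `B × {y}`. -/
def baseBlock (T : ContraTensor (IB.prod IF) (B × F)) (y : F) : ContraTensor IB B :=
  fun b ↦ pushforward (IB.prod IF) IB Prod.fst (b, y) (T (b, y))

/-- The component of `T` along `F`, restricted to the slice `{b} × F`. -/
def fiberBlock (T : ContraTensor (IB.prod IF) (B × F)) (b : B) : ContraTensor IF F :=
  fun y ↦ pushforward (IB.prod IF) IF Prod.snd (b, y) (T (b, y))

/-- The mixed components of `T` vanish. -/
structure IsBlockDiagonal (T : ContraTensor (IB.prod IF) (B × F)) : Prop where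
  base_fiber : ∀ (z : B × F) (p : TangentSpace IB z.1 →L[ℝ] ℝ) (q : TangentSpace IF z.2 →L[ℝ] ℝ),
    p (mfderiv (IB.prod IF) IB Prod.fst z
      (T z (q ∘L mfderiv (IB.prod IF) IF Prod.snd z))) = 0
  fiber_base : ∀ (z : B × F) (p : TangentSpace IB z.1 →L[ℝ] ℝ) (q : TangentSpace IF z.2 →L[ℝ] ℝ),
    q (mfderiv (IB.prod IF) IF Prod.snd z
      (T z (p ∘L mfderiv (IB.prod IF) IB Prod.fst z))) = 0

theorem mvfderiv_comp_fst {z : B × F} {f : B → ℝ} (hf : MDifferentiableAt IB 𝓘(ℝ, ℝ) f z.1) :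
    mvfderiv (IB.prod IF) (f ∘ Prod.fst) z =
      mvfderiv IB f z.1 ∘L mfderiv (IB.prod IF) IB Prod.fst z :=
  mvfderiv_comp z hf mdifferentiableAt_fst

theorem mvfderiv_comp_snd {z : B × F} {f : F → ℝ} (hf : MDifferentiableAt IF 𝓘(ℝ, ℝ) f z.2) :
    mvfderiv (IB.prod IF) (f ∘ Prod.snd) z =
      mvfderiv IF f z.2 ∘L mfderiv (IB.prod IF) IF Prod.snd z :=
  mvfderiv_comp z hf mdifferentiableAt_snd

theorem mvfderiv_prod_apply {z : B × F} {f : B × F → ℝ}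
    (hf : MDifferentiableAt (IB.prod IF) 𝓘(ℝ, ℝ) f z) (v : TangentSpace (IB.prod IF) z) :
    mvfderiv (IB.prod IF) f z v =
      mvfderiv IB (fun b ↦ f (b, z.2)) z.1 (mfderiv (IB.prod IF) IB Prod.fst z v)
      + mvfderiv IF (fun y ↦ f (z.1, y)) z.2 (mfderiv (IB.prod IF) IF Prod.snd z v) := by
  rw [mfderiv_fst, mfderiv_snd]
  exact mfderiv_prod_eq_add_apply hf

theorem contraction_fst_fst (T : ContraTensor (IB.prod IF) (B × F)) {z : B × F} {f h : B → ℝ}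
    (hf : MDifferentiableAt IB 𝓘(ℝ, ℝ) f z.1) (hh : MDifferentiableAt IB 𝓘(ℝ, ℝ) h z.1) :
    contraction (IB.prod IF) T (f ∘ Prod.fst) (h ∘ Prod.fst) z =
      contraction IB (baseBlock T z.2) f h z.1 := by
  rw [contraction, contraction, mvfderiv_comp_fst hf, mvfderiv_comp_fst hh]
  rfl

theorem contraction_snd_snd (T : ContraTensor (IB.prod IF) (B × F)) {z : B × F} {f h : F → ℝ}
    (hf : MDifferentiableAt IF 𝓘(ℝ, ℝ) f z.2) (hh : MDifferentiableAt IF 𝓘(ℝ, ℝ) h z.2) :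
    contraction (IB.prod IF) T (f ∘ Prod.snd) (h ∘ Prod.snd) z =
      contraction IF (fiberBlock T z.1) f h z.2 := by
  rw [contraction, contraction, mvfderiv_comp_snd hf, mvfderiv_comp_snd hh]
  rfl

theorem IsBlockDiagonal.contraction_fst_snd {T : ContraTensor (IB.prod IF) (B × F)}
    (hT : IsBlockDiagonal T) {z : B × F} {f : B → ℝ} {h : F → ℝ}
    (hf : MDifferentiableAt IB 𝓘(ℝ, ℝ) f z.1) (hh : MDifferentiableAt IF 𝓘(ℝ, ℝ) h z.2) :
    contraction (IB.prod IF) T (f ∘ Prod.fst) (h ∘ Prod.snd) z = 0 := by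
  rw [contraction, mvfderiv_comp_fst hf, mvfderiv_comp_snd hh]
  exact hT.base_fiber z _ _

theorem IsBlockDiagonal.contraction_snd_fst {T : ContraTensor (IB.prod IF) (B × F)}
    (hT : IsBlockDiagonal T) {z : B × F} {f : B → ℝ} {h : F → ℝ}
    (hf : MDifferentiableAt IB 𝓘(ℝ, ℝ) f z.1) (hh : MDifferentiableAt IF 𝓘(ℝ, ℝ) h z.2) :
    contraction (IB.prod IF) T (h ∘ Prod.snd) (f ∘ Prod.fst) z = 0 := by
  rw [contraction, mvfderiv_comp_fst hf, mvfderiv_comp_snd hh]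
  exact hT.fiber_base z _ _

theorem eq_zero_of_forall_dual {V : Type*} [NormedAddCommGroup V] [NormedSpace ℝ V] {v : V}
    (h : ∀ p : V →L[ℝ] ℝ, p v = 0) : v = 0 :=
  (SeparatingDual.eq_zero_iff_forall_dual_eq_zero (R := ℝ) v).2 h

theorem IsBlockDiagonal.mvfderiv_apply_fst {T : ContraTensor (IB.prod IF) (B × F)}
    (hT : IsBlockDiagonal T) {z : B × F} {f : B × F → ℝ} {u : B → ℝ}
    (hf : MDifferentiableAt (IB.prod IF) 𝓘(ℝ, ℝ) f z) (hu : MDifferentiableAt IB 𝓘(ℝ, ℝ) u z.1) :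
    mvfderiv (IB.prod IF) f z (T z (mvfderiv (IB.prod IF) (u ∘ Prod.fst) z)) =
      mvfderiv IB (fun b ↦ f (b, z.2)) z.1 (baseBlock T z.2 z.1 (mvfderiv IB u z.1)) := by
  have h0 : mfderiv (IB.prod IF) IF Prod.snd z
      (T z (mvfderiv IB u z.1 ∘L mfderiv (IB.prod IF) IB Prod.fst z)) = 0 :=
    eq_zero_of_forall_dual (V := EF) fun q ↦ hT.fiber_base z _ q
  rw [mvfderiv_comp_fst hu, mvfderiv_prod_apply hf, h0, map_zero, add_zero]
  rfl

theorem IsBlockDiagonal.mvfderiv_apply_snd {T : ContraTensor (IB.prod IF) (B × F)}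
    (hT : IsBlockDiagonal T) {z : B × F} {f : B × F → ℝ} {u : F → ℝ}
    (hf : MDifferentiableAt (IB.prod IF) 𝓘(ℝ, ℝ) f z) (hu : MDifferentiableAt IF 𝓘(ℝ, ℝ) u z.2) :
    mvfderiv (IB.prod IF) f z (T z (mvfderiv (IB.prod IF) (u ∘ Prod.snd) z)) =
      mvfderiv IF (fun y ↦ f (z.1, y)) z.2 (fiberBlock T z.1 z.2 (mvfderiv IF u z.2)) := by
  have h0 : mfderiv (IB.prod IF) IB Prod.fst z
      (T z (mvfderiv IF u z.2 ∘L mfderiv (IB.prod IF) IF Prod.snd z)) = 0 :=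
    eq_zero_of_forall_dual (V := EB) fun p ↦ hT.base_fiber z p _
  rw [mvfderiv_comp_snd hu, mvfderiv_prod_apply hf, h0, map_zero, zero_add]
  rfl

/-! ### The Schouten bracket on functions of one factor -/

theorem contMDiffAt_comp_fst {z : B × F} {f : B → ℝ}
    (hf : ContMDiffAt IB 𝓘(ℝ, ℝ) ∞ f z.1) :
    ContMDiffAt (IB.prod IF) 𝓘(ℝ, ℝ) ∞ (f ∘ Prod.fst) z :=
  hf.comp z contMDiffAt_fst

theorem contMDiffAt_comp_snd {z : B × F} {f : F → ℝ}
    (hf : ContMDiffAt IF 𝓘(ℝ, ℝ) ∞ f z.2) :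
    ContMDiffAt (IB.prod IF) 𝓘(ℝ, ℝ) ∞ (f ∘ Prod.snd) z :=
  hf.comp z contMDiffAt_snd

theorem contraction_fst_fst_slice [IsManifold IB ∞ B]
    (T : ContraTensor (IB.prod IF) (B × F)) {b : B} (y : F)
    {f h : B → ℝ} (hf : ContMDiffAt IB 𝓘(ℝ, ℝ) ∞ f b) (hh : ContMDiffAt IB 𝓘(ℝ, ℝ) ∞ h b) :
    (fun b' ↦ contraction (IB.prod IF) T (f ∘ Prod.fst) (h ∘ Prod.fst) (b', y)) =ᶠ[𝓝 b]
      contraction IB (baseBlock T y) f h := by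
  filter_upwards [eventually_mdifferentiableAt hf, eventually_mdifferentiableAt hh] with b' h1 h2
  exact contraction_fst_fst T (z := (b', y)) h1 h2

theorem contraction_snd_snd_slice [IsManifold IF ∞ F]
    (T : ContraTensor (IB.prod IF) (B × F)) (b : B) {y : F}
    {f h : F → ℝ} (hf : ContMDiffAt IF 𝓘(ℝ, ℝ) ∞ f y) (hh : ContMDiffAt IF 𝓘(ℝ, ℝ) ∞ h y) :
    (fun y' ↦ contraction (IB.prod IF) T (f ∘ Prod.snd) (h ∘ Prod.snd) (b, y')) =ᶠ[𝓝 y]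
      contraction IF (fiberBlock T b) f h := by
  filter_upwards [eventually_mdifferentiableAt hf, eventually_mdifferentiableAt hh] with y' h1 h2
  exact contraction_snd_snd T (z := (b, y')) h1 h2

variable {K G : ContraTensor (IB.prod IF) (B × F)}

theorem schouten_fst_fst_fst [IsManifold IB ∞ B]
    (hK : IsSymmetricTensorField (IB.prod IF) K) (hG : IsSymmetricTensorField (IB.prod IF) G)
    (hKb : IsBlockDiagonal K) (hGb : IsBlockDiagonal G) {z : B × F} {f₁ f₂ f₃ : B → ℝ}
    (hf₁ : ContMDiffAt IB 𝓘(ℝ, ℝ) ∞ f₁ z.1) (hf₂ : ContMDiffAt IB 𝓘(ℝ, ℝ) ∞ f₂ z.1)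
    (hf₃ : ContMDiffAt IB 𝓘(ℝ, ℝ) ∞ f₃ z.1) :
    schouten (IB.prod IF) K G (f₁ ∘ Prod.fst) (f₂ ∘ Prod.fst) (f₃ ∘ Prod.fst) z =
      schouten IB (baseBlock K z.2) (baseBlock G z.2) f₁ f₂ f₃ z.1 := by
  have key : ∀ {u f h : B → ℝ}, ContMDiffAt IB 𝓘(ℝ, ℝ) ∞ u z.1 →
      ContMDiffAt IB 𝓘(ℝ, ℝ) ∞ f z.1 → ContMDiffAt IB 𝓘(ℝ, ℝ) ∞ h z.1 →
      schoutenTerm (IB.prod IF) K G (u ∘ Prod.fst) (f ∘ Prod.fst) (h ∘ Prod.fst) z =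
        schoutenTerm IB (baseBlock K z.2) (baseBlock G z.2) u f h z.1 := by
    intro u f h hu hf hh
    have hu' := hu.mdifferentiableAt (by simp)
    rw [schoutenTerm, schoutenTerm, hKb.mvfderiv_apply_fst
        (hG.mdifferentiableAt (contMDiffAt_comp_fst hf) (contMDiffAt_comp_fst hh)) hu',
      hGb.mvfderiv_apply_fst (hK.mdifferentiableAt (contMDiffAt_comp_fst hf) (contMDiffAt_comp_fst hh)) hu',
      mvfderiv_congr (contraction_fst_fst_slice G z.2 hf hh),
      mvfderiv_congr (contraction_fst_fst_slice K z.2 hf hh)]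
  rw [schouten_eq, schouten_eq, key hf₁ hf₂ hf₃, key hf₂ hf₃ hf₁, key hf₃ hf₁ hf₂]

theorem schouten_snd_snd_snd [IsManifold IF ∞ F]
    (hK : IsSymmetricTensorField (IB.prod IF) K) (hG : IsSymmetricTensorField (IB.prod IF) G)
    (hKb : IsBlockDiagonal K) (hGb : IsBlockDiagonal G) {z : B × F} {f₁ f₂ f₃ : F → ℝ}
    (hf₁ : ContMDiffAt IF 𝓘(ℝ, ℝ) ∞ f₁ z.2) (hf₂ : ContMDiffAt IF 𝓘(ℝ, ℝ) ∞ f₂ z.2)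
    (hf₃ : ContMDiffAt IF 𝓘(ℝ, ℝ) ∞ f₃ z.2) :
    schouten (IB.prod IF) K G (f₁ ∘ Prod.snd) (f₂ ∘ Prod.snd) (f₃ ∘ Prod.snd) z =
      schouten IF (fiberBlock K z.1) (fiberBlock G z.1) f₁ f₂ f₃ z.2 := by
  have key : ∀ {u f h : F → ℝ}, ContMDiffAt IF 𝓘(ℝ, ℝ) ∞ u z.2 →
      ContMDiffAt IF 𝓘(ℝ, ℝ) ∞ f z.2 → ContMDiffAt IF 𝓘(ℝ, ℝ) ∞ h z.2 →
      schoutenTerm (IB.prod IF) K G (u ∘ Prod.snd) (f ∘ Prod.snd) (h ∘ Prod.snd) z =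
        schoutenTerm IF (fiberBlock K z.1) (fiberBlock G z.1) u f h z.2 := by
    intro u f h hu hf hh
    have hu' := hu.mdifferentiableAt (by simp)
    rw [schoutenTerm, schoutenTerm, hKb.mvfderiv_apply_snd
        (hG.mdifferentiableAt (contMDiffAt_comp_snd hf) (contMDiffAt_comp_snd hh)) hu',
      hGb.mvfderiv_apply_snd (hK.mdifferentiableAt (contMDiffAt_comp_snd hf) (contMDiffAt_comp_snd hh)) hu',
      mvfderiv_congr (contraction_snd_snd_slice G z.1 hf hh),
      mvfderiv_congr (contraction_snd_snd_slice K z.1 hf hh)]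
  rw [schouten_eq, schouten_eq, key hf₁ hf₂ hf₃, key hf₂ hf₃ hf₁, key hf₃ hf₁ hf₂]

variable [IsManifold IB ∞ B] [IsManifold IF ∞ F]

theorem IsBlockDiagonal.mvfderiv_contraction_fst_snd {T : ContraTensor (IB.prod IF) (B × F)}
    (hT : IsBlockDiagonal T) {z : B × F} {f : B → ℝ} {h : F → ℝ}
    (hf : ContMDiffAt IB 𝓘(ℝ, ℝ) ∞ f z.1) (hh : ContMDiffAt IF 𝓘(ℝ, ℝ) ∞ h z.2) :
    mvfderiv (IB.prod IF) (contraction (IB.prod IF) T (f ∘ Prod.fst) (h ∘ Prod.snd)) z = 0 := by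
  rw [mvfderiv_congr (h := fun _ ↦ 0), mvfderiv_const]
  filter_upwards [continuousAt_fst.eventually (eventually_mdifferentiableAt hf),
    continuousAt_snd.eventually (eventually_mdifferentiableAt hh)] with z' h1 h2
  exact hT.contraction_fst_snd h1 h2

theorem IsBlockDiagonal.mvfderiv_contraction_snd_fst {T : ContraTensor (IB.prod IF) (B × F)}
    (hT : IsBlockDiagonal T) {z : B × F} {f : B → ℝ} {h : F → ℝ}
    (hf : ContMDiffAt IB 𝓘(ℝ, ℝ) ∞ f z.1) (hh : ContMDiffAt IF 𝓘(ℝ, ℝ) ∞ h z.2) :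
    mvfderiv (IB.prod IF) (contraction (IB.prod IF) T (h ∘ Prod.snd) (f ∘ Prod.fst)) z = 0 := by
  rw [mvfderiv_congr (h := fun _ ↦ 0), mvfderiv_const]
  filter_upwards [continuousAt_fst.eventually (eventually_mdifferentiableAt hf),
    continuousAt_snd.eventually (eventually_mdifferentiableAt hh)] with z' h1 h2
  exact hT.contraction_snd_fst h1 h2

theorem schouten_snd_fst_fst
    (hK : IsSymmetricTensorField (IB.prod IF) K) (hG : IsSymmetricTensorField (IB.prod IF) G)
    (hKb : IsBlockDiagonal K) (hGb : IsBlockDiagonal G) {z : B × F} {u : F → ℝ} {f h : B → ℝ}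
    (hu : ContMDiffAt IF 𝓘(ℝ, ℝ) ∞ u z.2) (hf : ContMDiffAt IB 𝓘(ℝ, ℝ) ∞ f z.1)
    (hh : ContMDiffAt IB 𝓘(ℝ, ℝ) ∞ h z.1) :
    schouten (IB.prod IF) K G (u ∘ Prod.snd) (f ∘ Prod.fst) (h ∘ Prod.fst) z = (2 / 3 : ℝ) *
      (mvfderiv IF (fun y ↦ contraction IB (baseBlock G y) f h z.1) z.2
          (fiberBlock K z.1 z.2 (mvfderiv IF u z.2))
        - mvfderiv IF (fun y ↦ contraction IB (baseBlock K y) f h z.1) z.2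
          (fiberBlock G z.1 z.2 (mvfderiv IF u z.2))) := by
  have hu' := hu.mdifferentiableAt (by simp)
  have hf' := hf.mdifferentiableAt (by simp)
  have hh' := hh.mdifferentiableAt (by simp)
  have hs : ∀ T : ContraTensor (IB.prod IF) (B × F),
      (fun y ↦ contraction (IB.prod IF) T (f ∘ Prod.fst) (h ∘ Prod.fst) (z.1, y)) =
        fun y ↦ contraction IB (baseBlock T y) f h z.1 :=
    fun T ↦ funext fun y ↦ contraction_fst_fst T (z := (z.1, y)) hf' hh'
  simp only [schouten_eq, schoutenTerm]
  rw [hKb.mvfderiv_contraction_fst_snd hh hu, hGb.mvfderiv_contraction_fst_snd hh hu,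
    hKb.mvfderiv_contraction_snd_fst hf hu, hGb.mvfderiv_contraction_snd_fst hf hu,
    hKb.mvfderiv_apply_snd (hG.mdifferentiableAt (contMDiffAt_comp_fst hf) (contMDiffAt_comp_fst hh)) hu',
    hGb.mvfderiv_apply_snd (hK.mdifferentiableAt (contMDiffAt_comp_fst hf) (contMDiffAt_comp_fst hh)) hu', hs, hs]
  simp

theorem schouten_fst_snd_snd
    (hK : IsSymmetricTensorField (IB.prod IF) K) (hG : IsSymmetricTensorField (IB.prod IF) G)
    (hKb : IsBlockDiagonal K) (hGb : IsBlockDiagonal G) {z : B × F} {u : B → ℝ} {f h : F → ℝ}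
    (hu : ContMDiffAt IB 𝓘(ℝ, ℝ) ∞ u z.1) (hf : ContMDiffAt IF 𝓘(ℝ, ℝ) ∞ f z.2)
    (hh : ContMDiffAt IF 𝓘(ℝ, ℝ) ∞ h z.2) :
    schouten (IB.prod IF) K G (u ∘ Prod.fst) (f ∘ Prod.snd) (h ∘ Prod.snd) z = (2 / 3 : ℝ) *
      (mvfderiv IB (fun b ↦ contraction IF (fiberBlock G b) f h z.2) z.1
          (baseBlock K z.2 z.1 (mvfderiv IB u z.1))
        - mvfderiv IB (fun b ↦ contraction IF (fiberBlock K b) f h z.2) z.1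
          (baseBlock G z.2 z.1 (mvfderiv IB u z.1))) := by
  have hu' := hu.mdifferentiableAt (by simp)
  have hf' := hf.mdifferentiableAt (by simp)
  have hh' := hh.mdifferentiableAt (by simp)
  have hs : ∀ T : ContraTensor (IB.prod IF) (B × F),
      (fun b ↦ contraction (IB.prod IF) T (f ∘ Prod.snd) (h ∘ Prod.snd) (b, z.2)) =
        fun b ↦ contraction IF (fiberBlock T b) f h z.2 :=
    fun T ↦ funext fun b ↦ contraction_snd_snd T (z := (b, z.2)) hf' hh'
  simp only [schouten_eq, schoutenTerm]
  rw [hKb.mvfderiv_contraction_fst_snd hu hf, hGb.mvfderiv_contraction_fst_snd hu hf,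
    hKb.mvfderiv_contraction_snd_fst hu hh, hGb.mvfderiv_contraction_snd_fst hu hh,
    hKb.mvfderiv_apply_fst (hG.mdifferentiableAt (contMDiffAt_comp_snd hf) (contMDiffAt_comp_snd hh)) hu',
    hGb.mvfderiv_apply_fst (hK.mdifferentiableAt (contMDiffAt_comp_snd hf) (contMDiffAt_comp_snd hh)) hu', hs, hs]
  simp

/-- On a product, the Schouten bracket vanishes as soon as it vanishes on functions of one
factor. -/
theorem schouten_eq_zero_of_factors [IB.Boundaryless] [IF.Boundaryless] [FiniteDimensional ℝ EB]
    [FiniteDimensional ℝ EF]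
    (hK : IsSymmetricTensorField (IB.prod IF) K) (hG : IsSymmetricTensorField (IB.prod IF) G)
    {z : B × F}
    (hBBB : ∀ f₁ f₂ f₃ : B → ℝ, ContMDiffAt IB 𝓘(ℝ, ℝ) ∞ f₁ z.1 →
      ContMDiffAt IB 𝓘(ℝ, ℝ) ∞ f₂ z.1 → ContMDiffAt IB 𝓘(ℝ, ℝ) ∞ f₃ z.1 →
      schouten (IB.prod IF) K G (f₁ ∘ Prod.fst) (f₂ ∘ Prod.fst) (f₃ ∘ Prod.fst) z = 0)
    (hFBB : ∀ (u : F → ℝ) (f h : B → ℝ), ContMDiffAt IF 𝓘(ℝ, ℝ) ∞ u z.2 →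
      ContMDiffAt IB 𝓘(ℝ, ℝ) ∞ f z.1 → ContMDiffAt IB 𝓘(ℝ, ℝ) ∞ h z.1 →
      schouten (IB.prod IF) K G (u ∘ Prod.snd) (f ∘ Prod.fst) (h ∘ Prod.fst) z = 0)
    (hBFF : ∀ (u : B → ℝ) (f h : F → ℝ), ContMDiffAt IB 𝓘(ℝ, ℝ) ∞ u z.1 →
      ContMDiffAt IF 𝓘(ℝ, ℝ) ∞ f z.2 → ContMDiffAt IF 𝓘(ℝ, ℝ) ∞ h z.2 →
      schouten (IB.prod IF) K G (u ∘ Prod.fst) (f ∘ Prod.snd) (h ∘ Prod.snd) z = 0)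
    (hFFF : ∀ f₁ f₂ f₃ : F → ℝ, ContMDiffAt IF 𝓘(ℝ, ℝ) ∞ f₁ z.2 →
      ContMDiffAt IF 𝓘(ℝ, ℝ) ∞ f₂ z.2 → ContMDiffAt IF 𝓘(ℝ, ℝ) ∞ f₃ z.2 →
      schouten (IB.prod IF) K G (f₁ ∘ Prod.snd) (f₂ ∘ Prod.snd) (f₃ ∘ Prod.snd) z = 0)
    {f₁ f₂ f₃ : B × F → ℝ} (hf₁ : ContMDiffAt (IB.prod IF) 𝓘(ℝ, ℝ) ∞ f₁ z)
    (hf₂ : ContMDiffAt (IB.prod IF) 𝓘(ℝ, ℝ) ∞ f₂ z)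
    (hf₃ : ContMDiffAt (IB.prod IF) 𝓘(ℝ, ℝ) ∞ f₃ z) :
    schouten (IB.prod IF) K G f₁ f₂ f₃ z = 0 := by
  have split : ∀ {f : B × F → ℝ}, ContMDiffAt (IB.prod IF) 𝓘(ℝ, ℝ) ∞ f z →
      ∃ (fB : B → ℝ) (fF : F → ℝ), ContMDiffAt IB 𝓘(ℝ, ℝ) ∞ fB z.1 ∧
        ContMDiffAt IF 𝓘(ℝ, ℝ) ∞ fF z.2 ∧ ∀ h k : B × F → ℝ,
        ContMDiffAt (IB.prod IF) 𝓘(ℝ, ℝ) ∞ h z → ContMDiffAt (IB.prod IF) 𝓘(ℝ, ℝ) ∞ k z →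
        schouten (IB.prod IF) K G f h k z = schouten (IB.prod IF) K G (fB ∘ Prod.fst) h k z
          + schouten (IB.prod IF) K G (fF ∘ Prod.snd) h k z := by
    intro f hf
    have hB : ContMDiffAt IB 𝓘(ℝ, ℝ) ∞ (fun b ↦ f (b, z.2)) z.1 :=
      hf.comp z.1 (contMDiffAt_id.prodMk contMDiffAt_const)
    have hF : ContMDiffAt IF 𝓘(ℝ, ℝ) ∞ (fun y ↦ f (z.1, y)) z.2 :=
      hf.comp z.2 (contMDiffAt_const.prodMk contMDiffAt_id)
    refine ⟨_, _, hB, hF, fun h k hh hk ↦ ?_⟩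
    rw [← schouten_add_left hK hG (contMDiffAt_comp_fst hB) (contMDiffAt_comp_snd hF) hh hk]
    refine schouten_congr_left hK hG hf ((contMDiffAt_comp_fst hB).add (contMDiffAt_comp_snd hF)) hh hk ?_
    rw [mvfderiv_add ((contMDiffAt_comp_fst hB).mdifferentiableAt (by simp))
      ((contMDiffAt_comp_snd hF).mdifferentiableAt (by simp)),
      mvfderiv_comp_fst (hB.mdifferentiableAt (by simp)),
      mvfderiv_comp_snd (hF.mdifferentiableAt (by simp))]
    ext v
    exact mvfderiv_prod_apply (hf.mdifferentiableAt (by simp)) v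
  obtain ⟨b₁, y₁, hb₁, hy₁, h₁⟩ := split hf₁
  obtain ⟨b₂, y₂, hb₂, hy₂, h₂⟩ := split hf₂
  obtain ⟨b₃, y₃, hb₃, hy₃, h₃⟩ := split hf₃
  have cyc := fun f h k ↦ schouten_cycle (I := IB.prod IF) (M := B × F) K G f h k z
  have expand : ∀ p : B × F → ℝ, ContMDiffAt (IB.prod IF) 𝓘(ℝ, ℝ) ∞ p z →
      schouten (IB.prod IF) K G p f₂ f₃ z =
        schouten (IB.prod IF) K G (b₃ ∘ Prod.fst) p (b₂ ∘ Prod.fst) z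
        + schouten (IB.prod IF) K G (y₃ ∘ Prod.snd) p (b₂ ∘ Prod.fst) z
        + (schouten (IB.prod IF) K G (b₃ ∘ Prod.fst) p (y₂ ∘ Prod.snd) z
        + schouten (IB.prod IF) K G (y₃ ∘ Prod.snd) p (y₂ ∘ Prod.snd) z) := by
    intro p hp
    rw [cyc p f₂ f₃, h₂ _ _ hf₃ hp, cyc _ f₃ p, h₃ _ _ hp (contMDiffAt_comp_fst hb₂),
      cyc _ f₃ p, h₃ _ _ hp (contMDiffAt_comp_snd hy₂)]
  rw [h₁ _ _ hf₂ hf₃, expand _ (contMDiffAt_comp_fst hb₁), expand _ (contMDiffAt_comp_snd hy₁),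
    hBBB _ _ _ hb₃ hb₁ hb₂, hFBB _ _ _ hy₃ hb₁ hb₂,
    ← cyc (y₂ ∘ Prod.snd) (b₃ ∘ Prod.fst) (b₁ ∘ Prod.fst), hFBB _ _ _ hy₂ hb₃ hb₁,
    cyc (y₃ ∘ Prod.snd) (b₁ ∘ Prod.fst) (y₂ ∘ Prod.snd), hBFF _ _ _ hb₁ hy₂ hy₃,
    cyc (b₃ ∘ Prod.fst) (y₁ ∘ Prod.snd) (b₂ ∘ Prod.fst), hFBB _ _ _ hy₁ hb₂ hb₃,
    ← cyc (b₂ ∘ Prod.fst) (y₃ ∘ Prod.snd) (y₁ ∘ Prod.snd), hBFF _ _ _ hb₂ hy₃ hy₁,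
    hBFF _ _ _ hb₃ hy₁ hy₂, hFFF _ _ _ hy₃ hy₁ hy₂]
  simp

end Product

/-! ### Sums and multiples of tensor fields -/

section Operations

variable {E : Type*} [NormedAddCommGroup E] [NormedSpace ℝ E]
  {H : Type*} [TopologicalSpace H] {I : ModelWithCorners ℝ E H}
  {M : Type*} [TopologicalSpace M] [ChartedSpace H M]

theorem contraction_add (T S : ContraTensor I M) (f h : M → ℝ) :
    contraction I (fun x ↦ T x + S x) f h = contraction I T f h + contraction I S f h := by
  funext x
  simp [contraction]

theorem contraction_smul (c : M → ℝ) (T : ContraTensor I M) (f h : M → ℝ) :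
    contraction I (fun x ↦ c x • T x) f h = c * contraction I T f h := by
  funext x
  simp [contraction]

theorem IsSymmetricTensorField.add {T S : ContraTensor I M} (hT : IsSymmetricTensorField I T)
    (hS : IsSymmetricTensorField I S) : IsSymmetricTensorField I (fun x ↦ T x + S x) where
  symm x p q := by simp [hT.symm x p q, hS.symm x p q]
  smooth x f h hf hh := by
    have h1 := (hT.contMDiffAt hf hh).add (hS.contMDiffAt hf hh)
    rw [← contraction_add] at h1
    exact h1

theorem IsSymmetricTensorField.smul {T : ContraTensor I M} (hT : IsSymmetricTensorField I T)
    {c : M → ℝ} (hc : ContMDiff I 𝓘(ℝ, ℝ) ∞ c) :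
    IsSymmetricTensorField I (fun x ↦ c x • T x) where
  symm x p q := by simp [hT.symm x p q]
  smooth x f h hf hh := by
    have h1 := (hc x).mul (hT.contMDiffAt hf hh)
    rw [← contraction_smul] at h1
    exact h1

/-- The Schouten bracket of `T + c G` and `G` is that of `T` and `G`, for constant `c`. -/
theorem schouten_add_const_smul {T G : ContraTensor I M} (hT : IsSymmetricTensorField I T)
    (hG : IsSymmetricTensorField I G) (c : ℝ) {x : M} {f₁ f₂ f₃ : M → ℝ}
    (hf₁ : ContMDiffAt I 𝓘(ℝ, ℝ) ∞ f₁ x) (hf₂ : ContMDiffAt I 𝓘(ℝ, ℝ) ∞ f₂ x)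
    (hf₃ : ContMDiffAt I 𝓘(ℝ, ℝ) ∞ f₃ x) :
    schouten I (fun y ↦ T y + c • G y) G f₁ f₂ f₃ x = schouten I T G f₁ f₂ f₃ x := by
  have key : ∀ {u f h : M → ℝ}, ContMDiffAt I 𝓘(ℝ, ℝ) ∞ f x → ContMDiffAt I 𝓘(ℝ, ℝ) ∞ h x →
      schoutenTerm I (fun y ↦ T y + c • G y) G u f h x = schoutenTerm I T G u f h x := by
    intro u f h hf hh
    have h1 : contraction I (fun y ↦ T y + c • G y) f h =
        contraction I T f h + (fun _ ↦ c) * contraction I G f h := by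
      rw [contraction_add T (fun y ↦ c • G y), contraction_smul (fun _ ↦ c)]
    rw [schoutenTerm, schoutenTerm, h1, mvfderiv_add (hT.mdifferentiableAt hf hh)
      (mdifferentiableAt_const.mul (hG.mdifferentiableAt hf hh)),
      mvfderiv_mul mdifferentiableAt_const (hG.mdifferentiableAt hf hh), mvfderiv_const]
    simp
  rw [schouten_eq, schouten_eq, key hf₂ hf₃, key hf₃ hf₁, key hf₁ hf₂]

theorem schouten_smul_right {T G : ContraTensor I M} (hG : IsSymmetricTensorField I G) (c : ℝ)
    {x : M} {f₁ f₂ f₃ : M → ℝ}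
    (hf₁ : ContMDiffAt I 𝓘(ℝ, ℝ) ∞ f₁ x) (hf₂ : ContMDiffAt I 𝓘(ℝ, ℝ) ∞ f₂ x)
    (hf₃ : ContMDiffAt I 𝓘(ℝ, ℝ) ∞ f₃ x) :
    schouten I T (fun y ↦ c • G y) f₁ f₂ f₃ x = c * schouten I T G f₁ f₂ f₃ x := by
  have key : ∀ {u f h : M → ℝ}, ContMDiffAt I 𝓘(ℝ, ℝ) ∞ f x → ContMDiffAt I 𝓘(ℝ, ℝ) ∞ h x →
      schoutenTerm I T (fun y ↦ c • G y) u f h x = c * schoutenTerm I T G u f h x := by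
    intro u f h hf hh
    rw [schoutenTerm, schoutenTerm, contraction_smul (fun _ ↦ c),
      mvfderiv_mul mdifferentiableAt_const (hG.mdifferentiableAt hf hh), mvfderiv_const]
    simp [mul_sub]
  rw [schouten_eq, schouten_eq, key hf₂ hf₃, key hf₃ hf₁, key hf₁ hf₂]
  ring

end Operations

/-! ### Lifts to a product -/

section Lifts

variable {EB : Type*} [NormedAddCommGroup EB] [NormedSpace ℝ EB]
  {HB : Type*} [TopologicalSpace HB] {IB : ModelWithCorners ℝ EB HB}
  {B : Type*} [TopologicalSpace B] [ChartedSpace HB B]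
  {EF : Type*} [NormedAddCommGroup EF] [NormedSpace ℝ EF]
  {HF : Type*} [TopologicalSpace HF] {IF : ModelWithCorners ℝ EF HF}
  {F : Type*} [TopologicalSpace F] [ChartedSpace HF F]

theorem mfderiv_fst_liftBase (T : ContraTensor IB B) (z : B × F)
    (p : TangentSpace (IB.prod IF) z →L[ℝ] ℝ) :
    mfderiv (IB.prod IF) IB Prod.fst z (liftBase IB IF T z p) =
      T z.1 (p ∘L mfderiv IB (IB.prod IF) (fun b : B ↦ (b, z.2)) z.1) := by
  rw [mfderiv_fst, liftBase, pushforward, mfderiv_prod_left]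
  rfl

theorem mfderiv_snd_liftBase (T : ContraTensor IB B) (z : B × F)
    (p : TangentSpace (IB.prod IF) z →L[ℝ] ℝ) :
    mfderiv (IB.prod IF) IF Prod.snd z (liftBase IB IF T z p) = 0 := by
  rw [mfderiv_snd, liftBase, pushforward, mfderiv_prod_left]
  rfl

theorem mfderiv_snd_liftFiber (T : ContraTensor IF F) (z : B × F)
    (p : TangentSpace (IB.prod IF) z →L[ℝ] ℝ) :
    mfderiv (IB.prod IF) IF Prod.snd z (liftFiber IB IF T z p) =
      T z.2 (p ∘L mfderiv IF (IB.prod IF) (fun y : F ↦ (z.1, y)) z.2) := by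
  rw [mfderiv_snd, liftFiber, pushforward, mfderiv_prod_right]
  rfl

theorem mfderiv_fst_liftFiber (T : ContraTensor IF F) (z : B × F)
    (p : TangentSpace (IB.prod IF) z →L[ℝ] ℝ) :
    mfderiv (IB.prod IF) IB Prod.fst z (liftFiber IB IF T z p) = 0 := by
  rw [mfderiv_fst, liftFiber, pushforward, mfderiv_prod_right]
  rfl

theorem mfderiv_fst_comp_inclusion_base (z : B × F) :
    mfderiv (IB.prod IF) IB Prod.fst z ∘L mfderiv IB (IB.prod IF) (fun b : B ↦ (b, z.2)) z.1 =
      ContinuousLinearMap.id ℝ (TangentSpace IB z.1) := by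
  rw [mfderiv_fst, mfderiv_prod_left]
  rfl

theorem mfderiv_snd_comp_inclusion_fiber (z : B × F) :
    mfderiv (IB.prod IF) IF Prod.snd z ∘L mfderiv IF (IB.prod IF) (fun y : F ↦ (z.1, y)) z.2 =
      ContinuousLinearMap.id ℝ (TangentSpace IF z.2) := by
  rw [mfderiv_snd, mfderiv_prod_right]
  rfl

theorem mfderiv_fst_comp_inclusion_fiber (z : B × F) :
    mfderiv (IB.prod IF) IB Prod.fst z ∘L mfderiv IF (IB.prod IF) (fun y : F ↦ (z.1, y)) z.2 =
      0 := by
  rw [mfderiv_fst, mfderiv_prod_right]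
  rfl

theorem mfderiv_snd_comp_inclusion_base (z : B × F) :
    mfderiv (IB.prod IF) IF Prod.snd z ∘L mfderiv IB (IB.prod IF) (fun b : B ↦ (b, z.2)) z.1 =
      0 := by
  rw [mfderiv_snd, mfderiv_prod_left]
  rfl

theorem baseBlock_liftBase (T : ContraTensor IB B) (y : F) :
    baseBlock (liftBase IB IF T) y = T := by
  funext b
  ext p
  change mfderiv (IB.prod IF) IB Prod.fst (b, y) (liftBase IB IF T (b, y)
    (p ∘L mfderiv (IB.prod IF) IB Prod.fst (b, y))) = T b p
  rw [mfderiv_fst_liftBase, ContinuousLinearMap.comp_assoc, mfderiv_fst_comp_inclusion_base]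
  rfl

theorem fiberBlock_liftBase (T : ContraTensor IB B) (b : B) :
    fiberBlock (F := F) (liftBase IB IF T) b = 0 := by
  funext y
  ext p
  exact mfderiv_snd_liftBase T (b, y) _

theorem fiberBlock_liftFiber (T : ContraTensor IF F) (b : B) :
    fiberBlock (liftFiber IB IF T) b = T := by
  funext y
  ext p
  change mfderiv (IB.prod IF) IF Prod.snd (b, y) (liftFiber IB IF T (b, y)
    (p ∘L mfderiv (IB.prod IF) IF Prod.snd (b, y))) = T y p
  rw [mfderiv_snd_liftFiber, ContinuousLinearMap.comp_assoc, mfderiv_snd_comp_inclusion_fiber]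
  rfl

theorem baseBlock_liftFiber (T : ContraTensor IF F) (y : F) :
    baseBlock (B := B) (liftFiber IB IF T) y = 0 := by
  funext b
  ext p
  exact mfderiv_fst_liftFiber T (b, y) _

theorem isBlockDiagonal_liftBase (T : ContraTensor IB B) :
    IsBlockDiagonal (F := F) (liftBase IB IF T) where
  base_fiber z p q := by
    rw [mfderiv_fst_liftBase, ContinuousLinearMap.comp_assoc, mfderiv_snd_comp_inclusion_base]
    simp
  fiber_base z p q := by
    rw [mfderiv_snd_liftBase, map_zero]

theorem isBlockDiagonal_liftFiber (T : ContraTensor IF F) :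
    IsBlockDiagonal (B := B) (liftFiber IB IF T) where
  base_fiber z p q := by
    rw [mfderiv_fst_liftFiber, map_zero]
  fiber_base z p q := by
    rw [mfderiv_snd_liftFiber, ContinuousLinearMap.comp_assoc, mfderiv_fst_comp_inclusion_fiber]
    simp

theorem IsBlockDiagonal.add {T S : ContraTensor (IB.prod IF) (B × F)} (hT : IsBlockDiagonal T)
    (hS : IsBlockDiagonal S) : IsBlockDiagonal (fun z ↦ T z + S z) where
  base_fiber z p q := by simp [-mfderiv_fst, -mfderiv_snd, hT.base_fiber z p q, hS.base_fiber z p q]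
  fiber_base z p q := by simp [-mfderiv_fst, -mfderiv_snd, hT.fiber_base z p q, hS.fiber_base z p q]

theorem IsBlockDiagonal.smul {T : ContraTensor (IB.prod IF) (B × F)} (hT : IsBlockDiagonal T)
    (c : B × F → ℝ) : IsBlockDiagonal (fun z ↦ c z • T z) where
  base_fiber z p q := by simp [-mfderiv_fst, -mfderiv_snd, hT.base_fiber z p q]
  fiber_base z p q := by simp [-mfderiv_fst, -mfderiv_snd, hT.fiber_base z p q]

theorem baseBlock_add (T S : ContraTensor (IB.prod IF) (B × F)) (y : F) :
    baseBlock (fun z ↦ T z + S z) y = fun b ↦ baseBlock T y b + baseBlock S y b := by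
  funext b
  ext p
  simp [-mfderiv_fst, baseBlock, pushforward]

theorem fiberBlock_add (T S : ContraTensor (IB.prod IF) (B × F)) (b : B) :
    fiberBlock (fun z ↦ T z + S z) b = fun y ↦ fiberBlock T b y + fiberBlock S b y := by
  funext y
  ext p
  simp [-mfderiv_snd, fiberBlock, pushforward]

theorem baseBlock_smul (c : B × F → ℝ) (T : ContraTensor (IB.prod IF) (B × F)) (y : F) :
    baseBlock (fun z ↦ c z • T z) y = fun b ↦ c (b, y) • baseBlock T y b := by
  funext b
  ext p
  simp [-mfderiv_fst, baseBlock, pushforward]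

theorem fiberBlock_smul (c : B × F → ℝ) (T : ContraTensor (IB.prod IF) (B × F)) (b : B) :
    fiberBlock (fun z ↦ c z • T z) b = fun y ↦ c (b, y) • fiberBlock T b y := by
  funext y
  ext p
  simp [-mfderiv_snd, fiberBlock, pushforward]

theorem clm_prod_apply_eq_add (p : EB × EF →L[ℝ] ℝ) (v : EB × EF) :
    p v = p (v.1, 0) + p (0, v.2) := by
  rw [← map_add]
  simp

theorem covector_eq_add (z : B × F) (p : TangentSpace (IB.prod IF) z →L[ℝ] ℝ) :
    p = (p ∘L mfderiv IB (IB.prod IF) (fun b : B ↦ (b, z.2)) z.1) ∘L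
        mfderiv (IB.prod IF) IB Prod.fst z
      + (p ∘L mfderiv IF (IB.prod IF) (fun y : F ↦ (z.1, y)) z.2) ∘L
        mfderiv (IB.prod IF) IF Prod.snd z := by
  rw [mfderiv_fst, mfderiv_snd, mfderiv_prod_left, mfderiv_prod_right]
  ext v
  exact clm_prod_apply_eq_add p v

theorem IsBlockDiagonal.mfderiv_fst_apply {T : ContraTensor (IB.prod IF) (B × F)}
    (hT : IsBlockDiagonal T) (z : B × F) (p : TangentSpace (IB.prod IF) z →L[ℝ] ℝ) :
    mfderiv (IB.prod IF) IB Prod.fst z (T z p) = baseBlock T z.2 z.1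
      (p ∘L mfderiv IB (IB.prod IF) (fun b : B ↦ (b, z.2)) z.1) := by
  have h0 : ∀ q : TangentSpace IF z.2 →L[ℝ] ℝ, mfderiv (IB.prod IF) IB Prod.fst z
      (T z (q ∘L mfderiv (IB.prod IF) IF Prod.snd z)) = 0 := fun q ↦
    eq_zero_of_forall_dual (V := EB) fun p ↦ hT.base_fiber z p q
  conv_lhs => rw [covector_eq_add z p, map_add, map_add, h0, add_zero]
  rfl

theorem IsBlockDiagonal.mfderiv_snd_apply {T : ContraTensor (IB.prod IF) (B × F)}
    (hT : IsBlockDiagonal T) (z : B × F) (p : TangentSpace (IB.prod IF) z →L[ℝ] ℝ) :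
    mfderiv (IB.prod IF) IF Prod.snd z (T z p) = fiberBlock T z.1 z.2
      (p ∘L mfderiv IF (IB.prod IF) (fun y : F ↦ (z.1, y)) z.2) := by
  have h0 : ∀ q : TangentSpace IB z.1 →L[ℝ] ℝ, mfderiv (IB.prod IF) IF Prod.snd z
      (T z (q ∘L mfderiv (IB.prod IF) IB Prod.fst z)) = 0 := fun q ↦
    eq_zero_of_forall_dual (V := EF) fun p ↦ hT.fiber_base z q p
  conv_lhs => rw [covector_eq_add z p, map_add, map_add, h0, zero_add]
  rfl

theorem tangent_prod_ext {z : B × F} {v w : TangentSpace (IB.prod IF) z}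
    (h₁ : mfderiv (IB.prod IF) IB Prod.fst z v = mfderiv (IB.prod IF) IB Prod.fst z w)
    (h₂ : mfderiv (IB.prod IF) IF Prod.snd z v = mfderiv (IB.prod IF) IF Prod.snd z w) :
    v = w := by
  rw [mfderiv_fst] at h₁
  rw [mfderiv_snd] at h₂
  exact Prod.ext h₁ h₂

/-- A block diagonal tensor field is determined by its blocks. -/
theorem IsBlockDiagonal.ext {T S : ContraTensor (IB.prod IF) (B × F)} (hT : IsBlockDiagonal T)
    (hS : IsBlockDiagonal S) {z : B × F} (hb : baseBlock T z.2 z.1 = baseBlock S z.2 z.1)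
    (hf : fiberBlock T z.1 z.2 = fiberBlock S z.1 z.2) : T z = S z := by
  ext1 p
  refine tangent_prod_ext ?_ ?_
  · rw [hT.mfderiv_fst_apply, hS.mfderiv_fst_apply, hb]
  · rw [hT.mfderiv_snd_apply, hS.mfderiv_snd_apply, hf]

theorem isBlockDiagonal_lift_add (T : ContraTensor IB B) (c : B → ℝ) (S : ContraTensor IF F) :
    IsBlockDiagonal fun z : B × F ↦ liftBase IB IF T z + c z.1 • liftFiber IB IF S z :=
  (isBlockDiagonal_liftBase T).add ((isBlockDiagonal_liftFiber S).smul fun z ↦ c z.1)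

theorem baseBlock_lift_add (T : ContraTensor IB B) (c : B → ℝ) (S : ContraTensor IF F) (y : F) :
    baseBlock (fun z : B × F ↦ liftBase IB IF T z + c z.1 • liftFiber IB IF S z) y = T := by
  rw [baseBlock_add (liftBase IB IF T) (fun z ↦ c z.1 • liftFiber IB IF S z),
    baseBlock_smul (fun z ↦ c z.1), baseBlock_liftBase, baseBlock_liftFiber]
  funext b
  simp

theorem fiberBlock_lift_add (T : ContraTensor IB B) (c : B → ℝ) (S : ContraTensor IF F) (b : B) :
    fiberBlock (fun z : B × F ↦ liftBase IB IF T z + c z.1 • liftFiber IB IF S z) b =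
      fun y ↦ c b • S y := by
  rw [fiberBlock_add (liftBase IB IF T) (fun z ↦ c z.1 • liftFiber IB IF S z),
    fiberBlock_smul (fun z ↦ c z.1), fiberBlock_liftBase, fiberBlock_liftFiber]
  funext y
  simp

theorem mvfderiv_slice_fst {z : B × F} {f : B × F → ℝ}
    (hf : MDifferentiableAt (IB.prod IF) 𝓘(ℝ, ℝ) f z) :
    mvfderiv (IB.prod IF) f z ∘L mfderiv IB (IB.prod IF) (fun b : B ↦ (b, z.2)) z.1 =
      mvfderiv IB (fun b ↦ f (b, z.2)) z.1 :=
  (mvfderiv_comp z.1 (f := fun b : B ↦ (b, z.2)) hf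
    (mdifferentiableAt_id.prodMk mdifferentiableAt_const)).symm

theorem mvfderiv_slice_snd {z : B × F} {f : B × F → ℝ}
    (hf : MDifferentiableAt (IB.prod IF) 𝓘(ℝ, ℝ) f z) :
    mvfderiv (IB.prod IF) f z ∘L mfderiv IF (IB.prod IF) (fun y : F ↦ (z.1, y)) z.2 =
      mvfderiv IF (fun y ↦ f (z.1, y)) z.2 :=
  (mvfderiv_comp z.2 (f := fun y : F ↦ (z.1, y)) hf
    (mdifferentiableAt_const.prodMk mdifferentiableAt_id)).symm

theorem contraction_liftBase (T : ContraTensor IB B) {z : B × F} {f h : B × F → ℝ}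
    (hf : MDifferentiableAt (IB.prod IF) 𝓘(ℝ, ℝ) f z)
    (hh : MDifferentiableAt (IB.prod IF) 𝓘(ℝ, ℝ) h z) :
    contraction (IB.prod IF) (liftBase IB IF T) f h z =
      contraction IB T (fun b ↦ f (b, z.2)) (fun b ↦ h (b, z.2)) z.1 := by
  rw [contraction, contraction, ← mvfderiv_slice_fst hf, ← mvfderiv_slice_fst hh]
  rfl

theorem contraction_liftFiber (T : ContraTensor IF F) {z : B × F} {f h : B × F → ℝ}
    (hf : MDifferentiableAt (IB.prod IF) 𝓘(ℝ, ℝ) f z)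
    (hh : MDifferentiableAt (IB.prod IF) 𝓘(ℝ, ℝ) h z) :
    contraction (IB.prod IF) (liftFiber IB IF T) f h z =
      contraction IF T (fun y ↦ f (z.1, y)) (fun y ↦ h (z.1, y)) z.2 := by
  rw [contraction, contraction, ← mvfderiv_slice_snd hf, ← mvfderiv_slice_snd hh]
  rfl

theorem mvfderiv_add_const {E : Type*} [NormedAddCommGroup E] [NormedSpace ℝ E]
    {H : Type*} [TopologicalSpace H] {I : ModelWithCorners ℝ E H}
    {M : Type*} [TopologicalSpace M] [ChartedSpace H M] {f : M → ℝ} {x : M}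
    (hf : MDifferentiableAt I 𝓘(ℝ, ℝ) f x) (c : ℝ) :
    mvfderiv I (fun y ↦ f y + c) x = mvfderiv I f x := by
  have h1 := mvfderiv_add hf (mdifferentiableAt_const (c := c))
  rw [mvfderiv_const, add_zero] at h1
  exact h1

/-! ### The contravariant metric of a warped product -/

theorem warpedMetric_apply (gB : CovTensor IB B) (gF : CovTensor IF F) (ρ : B → ℝ) (z : B × F)
    (v : TangentSpace (IB.prod IF) z) : warpedMetric IB IF gB gF ρ z v =
      gB z.1 (mfderiv (IB.prod IF) IB Prod.fst z v) ∘L mfderiv (IB.prod IF) IB Prod.fst z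
      + ρ z.1 ^ 2 • (gF z.2 (mfderiv (IB.prod IF) IF Prod.snd z v) ∘L
        mfderiv (IB.prod IF) IF Prod.snd z) := rfl

variable [FiniteDimensional ℝ EB] [FiniteDimensional ℝ EF] [IsManifold IB ∞ B] [IsManifold IF ∞ F]
  {gB : CovTensor IB B} {gF : CovTensor IF F} {ρ : B → ℝ}

theorem cometric_warpedMetric (hB : IsPseudoRiemannianMetric IB gB)
    (hF : IsPseudoRiemannianMetric IF gF) (hρ : ∀ b, 0 < ρ b) :
    cometric (IB.prod IF) (warpedMetric IB IF gB gF ρ) = fun z : B × F ↦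
      liftBase IB IF (cometric IB gB) z + (ρ z.1 ^ 2)⁻¹ • liftFiber IB IF (cometric IF gF) z := by
  funext z
  have hρz : ρ z.1 ^ 2 ≠ 0 := (pow_pos (hρ z.1) 2).ne'
  set W : ContraTensor (IB.prod IF) (B × F) := fun z ↦
    liftBase IB IF (cometric IB gB) z + (ρ z.1 ^ 2)⁻¹ • liftFiber IB IF (cometric IF gF) z with hW
  have hWb : IsBlockDiagonal W :=
    isBlockDiagonal_lift_add (cometric IB gB) (fun b ↦ (ρ b ^ 2)⁻¹) (cometric IF gF)
  have hW₁ : ∀ p, mfderiv (IB.prod IF) IB Prod.fst z (W z p) = cometric IB gB z.1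
      (p ∘L mfderiv IB (IB.prod IF) (fun b : B ↦ (b, z.2)) z.1) := fun p ↦ by
    rw [hWb.mfderiv_fst_apply, hW,
      baseBlock_lift_add (cometric IB gB) (fun b ↦ (ρ b ^ 2)⁻¹) (cometric IF gF)]
  have hW₂ : ∀ p, mfderiv (IB.prod IF) IF Prod.snd z (W z p) = (ρ z.1 ^ 2)⁻¹ • cometric IF gF z.2
      (p ∘L mfderiv IF (IB.prod IF) (fun y : F ↦ (z.1, y)) z.2) := fun p ↦ by
    rw [hWb.mfderiv_snd_apply, hW,
      fiberBlock_lift_add (cometric IB gB) (fun b ↦ (ρ b ^ 2)⁻¹) (cometric IF gF)]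
    rfl
  have hg := warpedMetric_apply gB gF ρ z
  refine ContinuousLinearMap.inverse_eq ?_ ?_
  · ext1 p
    change warpedMetric IB IF gB gF ρ z (W z p) = p
    rw [hg, hW₁, hW₂, map_smul, hB.apply_cometric, hF.apply_cometric,
      ContinuousLinearMap.smul_comp, smul_smul, mul_inv_cancel₀ hρz, one_smul, ← covector_eq_add]
  · ext1 v
    change W z (warpedMetric IB IF gB gF ρ z v) = v
    refine tangent_prod_ext ?_ ?_
    · rw [hW₁, hg, ContinuousLinearMap.add_comp, ContinuousLinearMap.smul_comp,
        ContinuousLinearMap.comp_assoc, ContinuousLinearMap.comp_assoc,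
        mfderiv_fst_comp_inclusion_base, mfderiv_snd_comp_inclusion_base,
        ContinuousLinearMap.comp_zero, smul_zero, add_zero, ContinuousLinearMap.comp_id,
        hB.cometric_apply]
    · rw [hW₂, hg, ContinuousLinearMap.add_comp, ContinuousLinearMap.smul_comp,
        ContinuousLinearMap.comp_assoc, ContinuousLinearMap.comp_assoc,
        mfderiv_fst_comp_inclusion_fiber, mfderiv_snd_comp_inclusion_fiber,
        ContinuousLinearMap.comp_zero, zero_add, ContinuousLinearMap.comp_id, map_smul,
        hF.cometric_apply, smul_smul, inv_mul_cancel₀ hρz, one_smul]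

/-! ### Smoothness of lifts -/

variable [IB.Boundaryless] [IF.Boundaryless]

theorem IsSymmetricTensorField.liftBase {T : ContraTensor IB B}
    (hT : IsSymmetricTensorField IB T) :
    IsSymmetricTensorField (IB.prod IF) (liftBase IB IF T : ContraTensor (IB.prod IF) (B × F)) where
  symm z p q := hT.symm z.1 (p ∘L mfderiv IB (IB.prod IF) (fun b : B ↦ (b, z.2)) z.1)
    (q ∘L mfderiv IB (IB.prod IF) (fun b : B ↦ (b, z.2)) z.1)
  smooth z₀ f h hf hh := by
    refine contMDiffAt_contraction_of_chart (fun p q ↦ ?_) hf hh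
    have hs : ∀ p : EB × EF →L[ℝ] ℝ, ∀ z ∈ (extChartAt (IB.prod IF) z₀).source,
        mvfderiv IB (fun b ↦ (p ∘ extChartAt (IB.prod IF) z₀) (b, z.2)) z.1 =
          mvfderiv IB ((p ∘L ContinuousLinearMap.inl ℝ EB EF) ∘ extChartAt IB z₀.1) z.1 := by
      intro p z hz
      have hz' : z.1 ∈ (extChartAt IB z₀.1).source := by
        rw [extChartAt_prod] at hz
        exact hz.1
      rw [← mvfderiv_add_const ((contMDiffAt_chart_functional hz' _).mdifferentiableAt (by simp))
        (p (0, extChartAt IF z₀.2 z.2))]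
      congr 1
      funext b
      change p (extChartAt IB z₀.1 b, extChartAt IF z₀.2 z.2) =
        p (extChartAt IB z₀.1 b, 0) + p (0, extChartAt IF z₀.2 z.2)
      rw [← map_add]
      simp
    have h1 := contMDiffAt_comp_fst (IF := IF) (z := z₀) (hT.contMDiffAt
      (contMDiffAt_chart_functional (mem_extChartAt_source z₀.1)
        (p ∘L ContinuousLinearMap.inl ℝ EB EF))
      (contMDiffAt_chart_functional (mem_extChartAt_source z₀.1)
        (q ∘L ContinuousLinearMap.inl ℝ EB EF)))
    refine h1.congr_of_eventuallyEq ?_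
    filter_upwards [extChartAt_source_mem_nhds (I := IB.prod IF) z₀] with z hz
    rw [contraction_liftBase T ((contMDiffAt_chart_functional hz p).mdifferentiableAt (by simp))
      ((contMDiffAt_chart_functional hz q).mdifferentiableAt (by simp)), contraction, hs p z hz,
      hs q z hz]
    rfl

theorem IsSymmetricTensorField.liftFiber {T : ContraTensor IF F}
    (hT : IsSymmetricTensorField IF T) :
    IsSymmetricTensorField (IB.prod IF) (liftFiber IB IF T : ContraTensor (IB.prod IF) (B × F)) where
  symm z p q := hT.symm z.2 (p ∘L mfderiv IF (IB.prod IF) (fun y : F ↦ (z.1, y)) z.2)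
    (q ∘L mfderiv IF (IB.prod IF) (fun y : F ↦ (z.1, y)) z.2)
  smooth z₀ f h hf hh := by
    refine contMDiffAt_contraction_of_chart (fun p q ↦ ?_) hf hh
    have hs : ∀ p : EB × EF →L[ℝ] ℝ, ∀ z ∈ (extChartAt (IB.prod IF) z₀).source,
        mvfderiv IF (fun y ↦ (p ∘ extChartAt (IB.prod IF) z₀) (z.1, y)) z.2 =
          mvfderiv IF ((p ∘L ContinuousLinearMap.inr ℝ EB EF) ∘ extChartAt IF z₀.2) z.2 := by
      intro p z hz
      have hz' : z.2 ∈ (extChartAt IF z₀.2).source := by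
        rw [extChartAt_prod] at hz
        exact hz.2
      rw [← mvfderiv_add_const ((contMDiffAt_chart_functional hz' _).mdifferentiableAt (by simp))
        (p (extChartAt IB z₀.1 z.1, 0))]
      congr 1
      funext y
      change p (extChartAt IB z₀.1 z.1, extChartAt IF z₀.2 y) =
        p (0, extChartAt IF z₀.2 y) + p (extChartAt IB z₀.1 z.1, 0)
      rw [← map_add]
      simp
    have h1 := contMDiffAt_comp_snd (IB := IB) (z := z₀) (hT.contMDiffAt
      (contMDiffAt_chart_functional (mem_extChartAt_source z₀.2)
        (p ∘L ContinuousLinearMap.inr ℝ EB EF))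
      (contMDiffAt_chart_functional (mem_extChartAt_source z₀.2)
        (q ∘L ContinuousLinearMap.inr ℝ EB EF)))
    refine h1.congr_of_eventuallyEq ?_
    filter_upwards [extChartAt_source_mem_nhds (I := IB.prod IF) z₀] with z hz
    rw [contraction_liftFiber T ((contMDiffAt_chart_functional hz p).mdifferentiableAt (by simp))
      ((contMDiffAt_chart_functional hz q).mdifferentiableAt (by simp)), contraction, hs p z hz,
      hs q z hz]
    rfl

end Lifts

/-! ### Killing tensors on a warped product -/

section Warped

variable {EB : Type*} [NormedAddCommGroup EB] [NormedSpace ℝ EB]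
  {HB : Type*} [TopologicalSpace HB] {IB : ModelWithCorners ℝ EB HB}
  {B : Type*} [TopologicalSpace B] [ChartedSpace HB B]
  {EF : Type*} [NormedAddCommGroup EF] [NormedSpace ℝ EF]
  {HF : Type*} [TopologicalSpace HF] {IF : ModelWithCorners ℝ EF HF}
  {F : Type*} [TopologicalSpace F] [ChartedSpace HF F]

theorem IsSymmetricTensorField.baseBlock [IsManifold IB ∞ B]
    {K : ContraTensor (IB.prod IF) (B × F)} (hK : IsSymmetricTensorField (IB.prod IF) K) (y : F) :
    IsSymmetricTensorField IB (baseBlock K y) where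
  symm b p q := hK.symm (b, y) (p ∘L mfderiv (IB.prod IF) IB Prod.fst (b, y))
    (q ∘L mfderiv (IB.prod IF) IB Prod.fst (b, y))
  smooth b f h hf hh := by
    have h1 : ContMDiffAt IB 𝓘(ℝ, ℝ) ∞ (fun b' ↦ contraction (IB.prod IF) K (f ∘ Prod.fst)
        (h ∘ Prod.fst) (b', y)) b :=
      (hK.contMDiffAt (x := (b, y)) (contMDiffAt_comp_fst hf) (contMDiffAt_comp_fst hh)).comp b
        (contMDiffAt_id.prodMk contMDiffAt_const)
    exact h1.congr_of_eventuallyEq (contraction_fst_fst_slice K y hf hh).symm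

theorem IsSymmetricTensorField.fiberBlock [IsManifold IF ∞ F]
    {K : ContraTensor (IB.prod IF) (B × F)} (hK : IsSymmetricTensorField (IB.prod IF) K) (b : B) :
    IsSymmetricTensorField IF (fiberBlock K b) where
  symm y p q := hK.symm (b, y) (p ∘L mfderiv (IB.prod IF) IF Prod.snd (b, y))
    (q ∘L mfderiv (IB.prod IF) IF Prod.snd (b, y))
  smooth y f h hf hh := by
    have h1 : ContMDiffAt IF 𝓘(ℝ, ℝ) ∞ (fun y' ↦ contraction (IB.prod IF) K (f ∘ Prod.snd)
        (h ∘ Prod.snd) (b, y')) y :=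
      (hK.contMDiffAt (x := (b, y)) (contMDiffAt_comp_snd hf) (contMDiffAt_comp_snd hh)).comp y
        (contMDiffAt_const.prodMk contMDiffAt_id)
    exact h1.congr_of_eventuallyEq (contraction_snd_snd_slice K b hf hh).symm

theorem contMDiff_contraction_baseBlock {K : ContraTensor (IB.prod IF) (B × F)}
    (hK : IsSymmetricTensorField (IB.prod IF) K) {b : B} {f h : B → ℝ}
    (hf : ContMDiffAt IB 𝓘(ℝ, ℝ) ∞ f b) (hh : ContMDiffAt IB 𝓘(ℝ, ℝ) ∞ h b) :
    ContMDiff IF 𝓘(ℝ, ℝ) ∞ (fun y ↦ contraction IB (baseBlock K y) f h b) := by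
  intro y
  have h1 : ContMDiffAt IF 𝓘(ℝ, ℝ) ∞ (fun y' ↦ contraction (IB.prod IF) K (f ∘ Prod.fst)
      (h ∘ Prod.fst) (b, y')) y :=
    (hK.contMDiffAt (x := (b, y)) (contMDiffAt_comp_fst hf) (contMDiffAt_comp_fst hh)).comp y
      (contMDiffAt_const.prodMk contMDiffAt_id)
  refine h1.congr_of_eventuallyEq (.of_forall fun y' ↦ ?_)
  exact (contraction_fst_fst K (z := (b, y')) (hf.mdifferentiableAt (by simp))
    (hh.mdifferentiableAt (by simp))).symm

theorem contMDiff_contraction_fiberBlock {K : ContraTensor (IB.prod IF) (B × F)}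
    (hK : IsSymmetricTensorField (IB.prod IF) K) {y : F} {f h : F → ℝ}
    (hf : ContMDiffAt IF 𝓘(ℝ, ℝ) ∞ f y) (hh : ContMDiffAt IF 𝓘(ℝ, ℝ) ∞ h y) :
    ContMDiff IB 𝓘(ℝ, ℝ) ∞ (fun b ↦ contraction IF (fiberBlock K b) f h y) := by
  intro b
  have h1 : ContMDiffAt IB 𝓘(ℝ, ℝ) ∞ (fun b' ↦ contraction (IB.prod IF) K (f ∘ Prod.snd)
      (h ∘ Prod.snd) (b', y)) b :=
    (hK.contMDiffAt (x := (b, y)) (contMDiffAt_comp_snd hf) (contMDiffAt_comp_snd hh)).comp b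
      (contMDiffAt_id.prodMk contMDiffAt_const)
  refine h1.congr_of_eventuallyEq (.of_forall fun b' ↦ ?_)
  exact (contraction_snd_snd K (z := (b', y)) (hf.mdifferentiableAt (by simp))
    (hh.mdifferentiableAt (by simp))).symm

theorem contMDiff_inv_sq {ρ : B → ℝ} (hρs : ContMDiff IB 𝓘(ℝ, ℝ) ∞ ρ) (hρ : ∀ b, 0 < ρ b) :
    ContMDiff IB 𝓘(ℝ, ℝ) ∞ (fun b ↦ (ρ b ^ 2)⁻¹) := by
  intro b
  have h1 : ContDiffAt ℝ ∞ (fun r : ℝ ↦ (r ^ 2)⁻¹) (ρ b) :=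
    (contDiffAt_id.pow 2).inv (pow_pos (hρ b) 2).ne'
  exact h1.contMDiffAt.comp b (hρs b)

variable [IsManifold IB ∞ B] [IsManifold IF ∞ F]
  [IB.Boundaryless] [IF.Boundaryless] [FiniteDimensional ℝ EB] [FiniteDimensional ℝ EF]
  {gB : CovTensor IB B} {gF : CovTensor IF F} {ρ : B → ℝ}

theorem isSymmetricTensorField_cometric_warpedMetric (hB : IsPseudoRiemannianMetric IB gB)
    (hF : IsPseudoRiemannianMetric IF gF) (hρs : ContMDiff IB 𝓘(ℝ, ℝ) ∞ ρ) (hρ : ∀ b, 0 < ρ b) :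
    IsSymmetricTensorField (IB.prod IF) (cometric (IB.prod IF) (warpedMetric IB IF gB gF ρ)) := by
  rw [cometric_warpedMetric hB hF hρ]
  exact hB.isSymmetricTensorField_cometric.liftBase.add
    (hF.isSymmetricTensorField_cometric.liftFiber.smul
      ((contMDiff_inv_sq hρs hρ).comp contMDiff_fst))

/-- The Killing equation on a warped product, for a block diagonal tensor field, in terms of
the blocks. -/
theorem killingEquationOn_warpedMetric_iff (hB : IsPseudoRiemannianMetric IB gB)
    (hF : IsPseudoRiemannianMetric IF gF) (hρs : ContMDiff IB 𝓘(ℝ, ℝ) ∞ ρ) (hρ : ∀ b, 0 < ρ b)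
    {K : ContraTensor (IB.prod IF) (B × F)} (hK : IsSymmetricTensorField (IB.prod IF) K)
    (hKb : IsBlockDiagonal K) :
    KillingEquationOn (IB.prod IF) (warpedMetric IB IF gB gF ρ) K Set.univ ↔
      (∀ y, KillingEquationOn IB gB (baseBlock K y) Set.univ) ∧
      (∀ b, KillingEquationOn IF gF (fiberBlock K b) Set.univ) ∧
      (∀ (b : B) (f h : B → ℝ), ContMDiffAt IB 𝓘(ℝ, ℝ) ∞ f b → ContMDiffAt IB 𝓘(ℝ, ℝ) ∞ h b →
        ∀ y, mvfderiv IF (fun y ↦ contraction IB (baseBlock K y) f h b) y = 0) ∧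
      (∀ (y : F) (f h : F → ℝ), ContMDiffAt IF 𝓘(ℝ, ℝ) ∞ f y → ContMDiffAt IF 𝓘(ℝ, ℝ) ∞ h y →
        ∀ b, mvfderiv IB (fun b ↦ contraction IF (fiberBlock K b) f h y) b =
          contraction IF (cometric IF gF) f h y •
            gB b (baseBlock K y b (mvfderiv IB (fun b' ↦ (ρ b' ^ 2)⁻¹) b))) := by
  have hκs := contMDiff_inv_sq hρs hρ
  have hκ : ∀ b, (ρ b ^ 2)⁻¹ ≠ 0 := fun b ↦ inv_ne_zero (pow_pos (hρ b) 2).ne'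
  have hGBs := hB.isSymmetricTensorField_cometric
  have hGFs := hF.isSymmetricTensorField_cometric
  set G := cometric (IB.prod IF) (warpedMetric IB IF gB gF ρ) with hGdef
  have hG := isSymmetricTensorField_cometric_warpedMetric hB hF hρs hρ
  have hGe := cometric_warpedMetric hB hF hρ
  rw [← hGdef] at hG hGe
  have hGb : IsBlockDiagonal G := by
    rw [hGe]
    exact isBlockDiagonal_lift_add (cometric IB gB) (fun b ↦ (ρ b ^ 2)⁻¹) (cometric IF gF)
  have hG₁ : ∀ y, baseBlock G y = cometric IB gB := by
    rw [hGe]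
    exact baseBlock_lift_add (cometric IB gB) (fun b ↦ (ρ b ^ 2)⁻¹) (cometric IF gF)
  have hG₂ : ∀ b, fiberBlock G b = fun y ↦ (ρ b ^ 2)⁻¹ • cometric IF gF y := by
    rw [hGe]
    exact fiberBlock_lift_add (cometric IB gB) (fun b ↦ (ρ b ^ 2)⁻¹) (cometric IF gF)
  have hFBB : ∀ (z : B × F) (u : F → ℝ) (f h : B → ℝ), ContMDiffAt IF 𝓘(ℝ, ℝ) ∞ u z.2 →
      ContMDiffAt IB 𝓘(ℝ, ℝ) ∞ f z.1 → ContMDiffAt IB 𝓘(ℝ, ℝ) ∞ h z.1 →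
      schouten (IB.prod IF) K G (u ∘ Prod.snd) (f ∘ Prod.fst) (h ∘ Prod.fst) z =
        -(2 / 3 : ℝ) * (ρ z.1 ^ 2)⁻¹ *
          mvfderiv IF (fun y ↦ contraction IB (baseBlock K y) f h z.1) z.2
            (cometric IF gF z.2 (mvfderiv IF u z.2)) := by
    intro z u f h hu hf hh
    rw [schouten_snd_fst_fst hK hG hKb hGb hu hf hh, hG₂]
    simp only [hG₁]
    rw [mvfderiv_const]
    simp
    ring
  have hBFF : ∀ (z : B × F) (u : B → ℝ) (f h : F → ℝ), ContMDiffAt IB 𝓘(ℝ, ℝ) ∞ u z.1 →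
      ContMDiffAt IF 𝓘(ℝ, ℝ) ∞ f z.2 → ContMDiffAt IF 𝓘(ℝ, ℝ) ∞ h z.2 →
      schouten (IB.prod IF) K G (u ∘ Prod.fst) (f ∘ Prod.snd) (h ∘ Prod.snd) z =
        (2 / 3 : ℝ) * (contraction IF (cometric IF gF) f h z.2 *
          gB z.1 (baseBlock K z.2 z.1 (mvfderiv IB (fun b' ↦ (ρ b' ^ 2)⁻¹) z.1))
            (cometric IB gB z.1 (mvfderiv IB u z.1))
          - mvfderiv IB (fun b ↦ contraction IF (fiberBlock K b) f h z.2) z.1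
            (cometric IB gB z.1 (mvfderiv IB u z.1))) := by
    intro z u f h hu hf hh
    have h1 : (fun b ↦ contraction IF (fiberBlock G b) f h z.2) =
        (fun b ↦ (ρ b ^ 2)⁻¹) * fun _ ↦ contraction IF (cometric IF gF) f h z.2 := by
      funext b
      rw [hG₂, contraction_smul (fun _ ↦ (ρ b ^ 2)⁻¹)]
      rfl
    have h2 : gB z.1 (baseBlock K z.2 z.1 (mvfderiv IB (fun b' ↦ (ρ b' ^ 2)⁻¹) z.1))
        (cometric IB gB z.1 (mvfderiv IB u z.1)) =
        mvfderiv IB (fun b' ↦ (ρ b' ^ 2)⁻¹) z.1 (baseBlock K z.2 z.1 (mvfderiv IB u z.1)) := by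
      rw [hB.symm, hB.apply_cometric]
      exact (hK.baseBlock z.2).symm z.1 _ _
    rw [schouten_fst_snd_snd hK hG hKb hGb hu hf hh, hG₁, h1,
      mvfderiv_mul ((hκs z.1).mdifferentiableAt (by simp)) mdifferentiableAt_const, mvfderiv_const,
      h2]
    simp
  have hFFF : ∀ (z : B × F) (f₁ f₂ f₃ : F → ℝ), ContMDiffAt IF 𝓘(ℝ, ℝ) ∞ f₁ z.2 →
      ContMDiffAt IF 𝓘(ℝ, ℝ) ∞ f₂ z.2 → ContMDiffAt IF 𝓘(ℝ, ℝ) ∞ f₃ z.2 →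
      schouten (IB.prod IF) K G (f₁ ∘ Prod.snd) (f₂ ∘ Prod.snd) (f₃ ∘ Prod.snd) z =
        (ρ z.1 ^ 2)⁻¹ * schouten IF (fiberBlock K z.1) (cometric IF gF) f₁ f₂ f₃ z.2 := by
    intro z f₁ f₂ f₃ h₁ h₂ h₃
    rw [schouten_snd_snd_snd hK hG hKb hGb h₁ h₂ h₃, hG₂, schouten_smul_right hGFs _ h₁ h₂ h₃]
  have hBBB : ∀ (z : B × F) (f₁ f₂ f₃ : B → ℝ), ContMDiffAt IB 𝓘(ℝ, ℝ) ∞ f₁ z.1 →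
      ContMDiffAt IB 𝓘(ℝ, ℝ) ∞ f₂ z.1 → ContMDiffAt IB 𝓘(ℝ, ℝ) ∞ f₃ z.1 →
      schouten (IB.prod IF) K G (f₁ ∘ Prod.fst) (f₂ ∘ Prod.fst) (f₃ ∘ Prod.fst) z =
        schouten IB (baseBlock K z.2) (cometric IB gB) f₁ f₂ f₃ z.1 := by
    intro z f₁ f₂ f₃ h₁ h₂ h₃
    rw [schouten_fst_fst_fst hK hG hKb hGb h₁ h₂ h₃, hG₁]
  constructor
  · intro hkill
    refine ⟨fun y b _ f₁ f₂ f₃ h₁ h₂ h₃ ↦ ?_, fun b y _ f₁ f₂ f₃ h₁ h₂ h₃ ↦ ?_,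
      fun b f h hf hh y ↦ ?_, fun y f h hf hh b ↦ ?_⟩
    · rw [← hBBB (b, y) _ _ _ h₁ h₂ h₃]
      exact hkill _ trivial _ _ _ (contMDiffAt_comp_fst h₁) (contMDiffAt_comp_fst h₂)
        (contMDiffAt_comp_fst h₃)
    · have h0 := hkill (b, y) trivial _ _ _ (contMDiffAt_comp_snd h₁) (contMDiffAt_comp_snd h₂)
        (contMDiffAt_comp_snd h₃)
      rw [← hGdef, hFFF (b, y) _ _ _ h₁ h₂ h₃] at h0
      exact (mul_eq_zero.1 h0).resolve_left (hκ b)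
    · ext v
      obtain ⟨u, hu, hdu⟩ := exists_mvfderiv_eq y (gF y v)
      have h0 := hkill (b, y) trivial _ _ _ (contMDiffAt_comp_snd hu) (contMDiffAt_comp_fst hf)
        (contMDiffAt_comp_fst hh)
      rw [← hGdef, hFBB (b, y) _ _ _ hu hf hh, hdu, hF.cometric_apply] at h0
      have h1 := (mul_eq_zero.1 h0).resolve_left
        (mul_ne_zero (by norm_num) (hκ b))
      simpa using! h1
    · ext v
      obtain ⟨u, hu, hdu⟩ := exists_mvfderiv_eq b (gB b v)
      have h0 := hkill (b, y) trivial _ _ _ (contMDiffAt_comp_fst hu) (contMDiffAt_comp_snd hf)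
        (contMDiffAt_comp_snd hh)
      rw [← hGdef, hBFF (b, y) _ _ _ hu hf hh, hdu, hB.cometric_apply] at h0
      have h1 := (mul_eq_zero.1 h0).resolve_left (by norm_num)
      exact (sub_eq_zero.1 h1).symm
  · rintro ⟨h₁, h₂, h₃, h₄⟩ z - f₁ f₂ f₃ hf₁ hf₂ hf₃
    rw [← hGdef]
    refine schouten_eq_zero_of_factors hK hG ?_ ?_ ?_ ?_ hf₁ hf₂ hf₃
    · intro f₁ f₂ f₃ hf₁ hf₂ hf₃
      rw [hBBB z _ _ _ hf₁ hf₂ hf₃]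
      exact h₁ z.2 z.1 trivial _ _ _ hf₁ hf₂ hf₃
    · intro u f h hu hf hh
      rw [hFBB z _ _ _ hu hf hh, h₃ z.1 f h hf hh]
      simp
    · intro u f h hu hf hh
      rw [hBFF z _ _ _ hu hf hh, h₄ z.2 f h hf hh]
      simp
    · intro f₁ f₂ f₃ hf₁ hf₂ hf₃
      rw [hFFF z _ _ _ hf₁ hf₂ hf₃, h₂ z.1 z.2 trivial _ _ _ hf₁ hf₂ hf₃, mul_zero]

end Warped

section Decomposition

theorem clm_eq_of_forall_dual {V W : Type*} [NormedAddCommGroup V] [NormedSpace ℝ V]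
    [NormedAddCommGroup W] [NormedSpace ℝ W] {T S : V →L[ℝ] W}
    (h : ∀ (p : W →L[ℝ] ℝ) (q : V), p (T q) = p (S q)) : T = S := by
  ext q
  refine sub_eq_zero.1 (eq_zero_of_forall_dual fun p ↦ ?_)
  rw [map_sub, h, sub_self]

variable {EB : Type*} [NormedAddCommGroup EB] [NormedSpace ℝ EB]
  {HB : Type*} [TopologicalSpace HB] {IB : ModelWithCorners ℝ EB HB}
  {B : Type*} [TopologicalSpace B] [ChartedSpace HB B]
  {EF : Type*} [NormedAddCommGroup EF] [NormedSpace ℝ EF]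
  {HF : Type*} [TopologicalSpace HF] {IF : ModelWithCorners ℝ EF HF}
  {F : Type*} [TopologicalSpace F] [ChartedSpace HF F]

section Blocks

variable (T : ContraTensor IB B) (c : B → ℝ) (S R : ContraTensor IF F)

theorem isBlockDiagonal_lift_add_add :
    IsBlockDiagonal fun z : B × F ↦
      liftBase IB IF T z + c z.1 • liftFiber IB IF S z + liftFiber IB IF R z :=
  (isBlockDiagonal_lift_add T c S).add (isBlockDiagonal_liftFiber R)

theorem baseBlock_lift_add_add (y : F) :
    baseBlock (fun z : B × F ↦
      liftBase IB IF T z + c z.1 • liftFiber IB IF S z + liftFiber IB IF R z) y = T := by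
  rw [baseBlock_add (fun z ↦ liftBase IB IF T z + c z.1 • liftFiber IB IF S z)
    (liftFiber IB IF R), baseBlock_lift_add, baseBlock_liftFiber]
  funext b
  simp

theorem fiberBlock_lift_add_add (b : B) :
    fiberBlock (fun z : B × F ↦
      liftBase IB IF T z + c z.1 • liftFiber IB IF S z + liftFiber IB IF R z) b =
      fun y ↦ R y + c b • S y := by
  rw [fiberBlock_add (fun z ↦ liftBase IB IF T z + c z.1 • liftFiber IB IF S z)
    (liftFiber IB IF R), fiberBlock_lift_add, fiberBlock_liftFiber]
  funext y
  exact add_comm _ _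

end Blocks

variable [IsManifold IB ∞ B] [IsManifold IF ∞ F]
  [IB.Boundaryless] [IF.Boundaryless] [FiniteDimensional ℝ EB] [FiniteDimensional ℝ EF]
  {gB : CovTensor IB B} {gF : CovTensor IF F} {ρ : B → ℝ}

/-- Sufficiency on the product: the lifted tensor field satisfies the Killing equation. -/
theorem killingEquationOn_lift_add_add (hB : IsPseudoRiemannianMetric IB gB)
    (hF : IsPseudoRiemannianMetric IF gF) (hρs : ContMDiff IB 𝓘(ℝ, ℝ) ∞ ρ) (hρ : ∀ b, 0 < ρ b)
    {K' : ContraTensor IB B} {Kt : ContraTensor IF F} {t : B → ℝ} (hK' : IsKillingTensor IB gB K')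
    (hKt : IsKillingTensor IF gF Kt) (ht : ContMDiff IB 𝓘(ℝ, ℝ) ∞ t)
    (hdt : ∀ b : B, mvfderiv IB t b =
      gB b (K' b (mvfderiv IB (fun b' ↦ (ρ b' ^ 2)⁻¹) b))) :
    KillingEquationOn (IB.prod IF) (warpedMetric IB IF gB gF ρ) (fun z : B × F ↦
      liftBase IB IF K' z + t z.1 • liftFiber IB IF (cometric IF gF) z + liftFiber IB IF Kt z)
      Set.univ := by
  have hGF := hF.isSymmetricTensorField_cometric
  rw [killingEquationOn_warpedMetric_iff hB hF hρs hρ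
    ((hK'.isSymmetricTensorField.liftBase.add (hGF.liftFiber.smul
      (c := fun z : B × F ↦ t z.1) (ht.comp contMDiff_fst))).add hKt.isSymmetricTensorField.liftFiber) (isBlockDiagonal_lift_add_add _ _ _ _)]
  simp only [baseBlock_lift_add_add, fiberBlock_lift_add_add]
  refine ⟨fun _ ↦ hK'.killing, fun b y _ f₁ f₂ f₃ h₁ h₂ h₃ ↦ ?_, fun b f h _ _ y ↦ ?_,
    fun y f h _ _ b ↦ ?_⟩
  · rw [schouten_add_const_smul hKt.isSymmetricTensorField hGF _ h₁ h₂ h₃]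
    exact hKt.killing y trivial _ _ _ h₁ h₂ h₃
  · exact mvfderiv_const _
  · have h1 : (fun b ↦ contraction IF (fun y ↦ Kt y + t b • cometric IF gF y) f h y) =
        (fun _ ↦ contraction IF Kt f h y) + t * fun _ ↦ contraction IF (cometric IF gF) f h y := by
      funext b
      rw [contraction_add Kt (fun y ↦ t b • cometric IF gF y), contraction_smul (fun _ ↦ t b)]
      rfl
    have htb : MDifferentiableAt IB 𝓘(ℝ, ℝ) t b := (ht b).mdifferentiableAt (by simp)
    rw [h1, mvfderiv_add mdifferentiableAt_const (htb.mul mdifferentiableAt_const),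
      mvfderiv_mul htb mdifferentiableAt_const, mvfderiv_const, mvfderiv_const, hdt]
    simp

/-- Necessity on the product: a block diagonal Killing tensor decomposes. -/
theorem exists_decomposition [ConnectedSpace B] [ConnectedSpace F]
    (hdim : 0 < Module.finrank ℝ EF) (hB : IsPseudoRiemannianMetric IB gB)
    (hF : IsPseudoRiemannianMetric IF gF) (hρs : ContMDiff IB 𝓘(ℝ, ℝ) ∞ ρ) (hρ : ∀ b, 0 < ρ b)
    {K : ContraTensor (IB.prod IF) (B × F)} (hK : IsSymmetricTensorField (IB.prod IF) K)
    (hKb : IsBlockDiagonal K)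
    (hkill : KillingEquationOn (IB.prod IF) (warpedMetric IB IF gB gF ρ) K Set.univ) :
    ∃ (K' : ContraTensor IB B) (Kt : ContraTensor IF F) (t : B → ℝ),
      IsKillingTensor IB gB K' ∧ IsKillingTensor IF gF Kt ∧ ContMDiff IB 𝓘(ℝ, ℝ) ∞ t ∧
      (∀ z : B × F, K z = liftBase IB IF K' z + t z.1 • liftFiber IB IF (cometric IF gF) z
        + liftFiber IB IF Kt z) ∧
      (∀ b : B, mvfderiv IB t b =
        gB b (K' b (mvfderiv IB (fun b' ↦ (ρ b' ^ 2)⁻¹) b))) := by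
  obtain ⟨h₁, h₂, h₃, h₄⟩ := (killingEquationOn_warpedMetric_iff hB hF hρs hρ hK hKb).1 hkill
  have hGF := hF.isSymmetricTensorField_cometric
  obtain ⟨b₀⟩ := (inferInstance : Nonempty B)
  obtain ⟨y₀⟩ := (inferInstance : Nonempty F)
  have hbase : ∀ (b : B) (y : F), baseBlock K y b = baseBlock K y₀ b := by
    intro b y
    refine clm_eq_of_forall_dual (V := EB →L[ℝ] ℝ) (W := EB) fun p q ↦ ?_
    obtain ⟨f, hf, rfl⟩ := exists_mvfderiv_eq (I := IB) b p
    obtain ⟨h, hh, rfl⟩ := exists_mvfderiv_eq (I := IB) b q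
    exact eq_of_mvfderiv_eq_zero
      ((contMDiff_contraction_baseBlock hK hf hh).mdifferentiable (by simp)) (h₃ b f h hf hh) y y₀
  obtain ⟨f₀, h₀, hf₀, hh₀, hc₀⟩ : ∃ f₀ h₀ : F → ℝ, ContMDiffAt IF 𝓘(ℝ, ℝ) ∞ f₀ y₀ ∧
      ContMDiffAt IF 𝓘(ℝ, ℝ) ∞ h₀ y₀ ∧ contraction IF (cometric IF gF) f₀ h₀ y₀ ≠ 0 := by
    obtain ⟨v, p, hp⟩ : ∃ (v : TangentSpace IF y₀) (p : TangentSpace IF y₀ →L[ℝ] ℝ), p v ≠ 0 := by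
      have : Nontrivial EF := Module.nontrivial_of_finrank_pos hdim
      obtain ⟨v, hv⟩ := exists_ne (0 : EF)
      obtain ⟨p, hp⟩ := SeparatingDual.exists_ne_zero (R := ℝ) hv
      exact ⟨v, p, hp⟩
    obtain ⟨f, hf, hfp⟩ := exists_mvfderiv_eq (I := IF) y₀ p
    obtain ⟨h, hh, hhq⟩ := exists_mvfderiv_eq (I := IF) y₀ (gF y₀ v)
    refine ⟨f, h, hf, hh, ?_⟩
    rw [contraction, hfp, hhq, hF.cometric_apply]
    exact hp
  set c₀ := contraction IF (cometric IF gF) f₀ h₀ y₀ with hc₀_def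
  let t : B → ℝ := fun b ↦ c₀⁻¹ * contraction IF (fiberBlock K b) f₀ h₀ y₀
  have hks := contMDiff_contraction_fiberBlock hK hf₀ hh₀
  have ht : ContMDiff IB 𝓘(ℝ, ℝ) ∞ t := contMDiff_const.mul hks
  have hdt : ∀ b : B, mvfderiv IB t b =
      gB b (baseBlock K y₀ b (mvfderiv IB (fun b' ↦ (ρ b' ^ 2)⁻¹) b)) := by
    intro b
    have h5 : t = (fun _ ↦ c₀⁻¹) * fun b ↦ contraction IF (fiberBlock K b) f₀ h₀ y₀ := rfl
    rw [h5, mvfderiv_mul mdifferentiableAt_const ((hks b).mdifferentiableAt (by simp)),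
      mvfderiv_const, h₄ y₀ f₀ h₀ hf₀ hh₀ b, smul_zero, add_zero, smul_smul,
      ← hc₀_def, inv_mul_cancel₀ hc₀, one_smul]
  have hfiber : ∀ (y : F) (f h : F → ℝ), ContMDiffAt IF 𝓘(ℝ, ℝ) ∞ f y →
      ContMDiffAt IF 𝓘(ℝ, ℝ) ∞ h y → ∀ b,
      contraction IF (fiberBlock K b) f h y - t b * contraction IF (cometric IF gF) f h y =
        contraction IF (fiberBlock K b₀) f h y - t b₀ * contraction IF (cometric IF gF) f h y := by
    intro y f h hf hh b
    have hs := contMDiff_contraction_fiberBlock hK hf hh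
    have hd1 : MDifferentiable IB 𝓘(ℝ, ℝ) (fun b ↦ contraction IF (fiberBlock K b) f h y) :=
      hs.mdifferentiable (by simp)
    have hd2 : MDifferentiable IB 𝓘(ℝ, ℝ) t := ht.mdifferentiable (by simp)
    have hd3 : ∀ b, MDifferentiableAt IB 𝓘(ℝ, ℝ)
        (t * fun _ ↦ contraction IF (cometric IF gF) f h y) b :=
      fun b ↦ (hd2 b).mul mdifferentiableAt_const
    refine eq_of_mvfderiv_eq_zero (I := IB)
      (f := (fun b ↦ contraction IF (fiberBlock K b) f h y) -
        t * fun _ ↦ contraction IF (cometric IF gF) f h y)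
      (fun b ↦ (hd1 b).sub (hd3 b)) (fun b ↦ ?_) b b₀
    rw [mvfderiv_sub (hd1 b) (hd3 b), mvfderiv_mul (hd2 b) mdifferentiableAt_const, mvfderiv_const,
      h₄ y f h hf hh b, hdt, hbase, smul_zero, zero_add, sub_self]
  let Kt : ContraTensor IF F := fun y ↦ fiberBlock K b₀ y + (-t b₀) • cometric IF gF y
  have hKts : IsSymmetricTensorField IF Kt :=
    (hK.fiberBlock b₀).add (hGF.smul (c := fun _ ↦ -t b₀) contMDiff_const)
  refine ⟨baseBlock K y₀, Kt, t, ⟨hK.baseBlock y₀, h₁ y₀⟩, ⟨hKts, ?_⟩, ht, fun z ↦ ?_, hdt⟩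
  · intro y _ f₁ f₂ f₃ hf₁ hf₂ hf₃
    rw [schouten_add_const_smul (hK.fiberBlock b₀) hGF _ hf₁ hf₂ hf₃]
    exact h₂ b₀ y trivial _ _ _ hf₁ hf₂ hf₃
  · refine hKb.ext (isBlockDiagonal_lift_add_add (baseBlock K y₀) t (cometric IF gF) Kt) ?_ ?_
    · rw [baseBlock_lift_add_add, hbase]
    · rw [fiberBlock_lift_add_add]
      refine clm_eq_of_forall_dual (V := EF →L[ℝ] ℝ) (W := EF) fun p q ↦ ?_
      obtain ⟨f, hf, rfl⟩ := exists_mvfderiv_eq (I := IF) z.2 p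
      obtain ⟨h, hh, rfl⟩ := exists_mvfderiv_eq (I := IF) z.2 q
      have h6 := hfiber z.2 f h hf hh z.1
      change contraction IF (fiberBlock K z.1) f h z.2 = contraction IF
        (fun y ↦ (fiberBlock K b₀ y + (-t b₀) • cometric IF gF y) + t z.1 • cometric IF gF y)
          f h z.2
      rw [contraction_add (fun y ↦ fiberBlock K b₀ y + (-t b₀) • cometric IF gF y)
        (fun y ↦ t z.1 • cometric IF gF y), contraction_add (fiberBlock K b₀)
        (fun y ↦ (-t b₀) • cometric IF gF y), contraction_smul (fun _ ↦ t z.1),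
        contraction_smul (fun _ ↦ -t b₀)]
      simp only [Pi.add_apply, Pi.mul_apply]
      linarith

/-- The lift of a Killing tensor on the fiber is a Killing tensor on the warped product. -/
theorem IsKillingTensor.liftFiber (hB : IsPseudoRiemannianMetric IB gB)
    (hF : IsPseudoRiemannianMetric IF gF) (hρs : ContMDiff IB 𝓘(ℝ, ℝ) ∞ ρ) (hρ : ∀ b, 0 < ρ b)
    {Kt : ContraTensor IF F} (hKt : IsKillingTensor IF gF Kt) :
    IsKillingTensor (IB.prod IF) (warpedMetric IB IF gB gF ρ)
      (liftFiber IB IF Kt : ContraTensor (IB.prod IF) (B × F)) where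
  isSymmetricTensorField := hKt.isSymmetricTensorField.liftFiber
  killing := by
    rw [killingEquationOn_warpedMetric_iff hB hF hρs hρ hKt.isSymmetricTensorField.liftFiber
      (isBlockDiagonal_liftFiber Kt)]
    simp only [baseBlock_liftFiber, fiberBlock_liftFiber]
    refine ⟨fun _ b _ f₁ f₂ f₃ h₁ h₂ h₃ ↦ ?_, fun _ ↦ hKt.killing, fun b f h _ _ y ↦ ?_,
      fun y f h _ _ b ↦ ?_⟩
    · have h0 : ∀ f h : B → ℝ, contraction IB (0 : ContraTensor IB B) f h = fun _ ↦ 0 := by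
        intro f h
        funext b
        simp [contraction]
      simp [schouten_eq, schoutenTerm, h0, mvfderiv_const]
    · exact mvfderiv_const _
    · rw [mvfderiv_const]
      simp

end Decomposition

/-! ### Transport by a local diffeomorphism -/

section Transport

variable {E : Type*} [NormedAddCommGroup E] [NormedSpace ℝ E]
  {H : Type*} [TopologicalSpace H] {I : ModelWithCorners ℝ E H}
  {N : Type*} [TopologicalSpace N] [ChartedSpace H N]
  {E' : Type*} [NormedAddCommGroup E'] [NormedSpace ℝ E']
  {H' : Type*} [TopologicalSpace H'] {J : ModelWithCorners ℝ E' H'}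
  {M : Type*} [TopologicalSpace M] [ChartedSpace H' M]

variable (I J) in
/-- Pull-back of a contravariant 2-tensor field by a map with invertible differential. -/
def pullbackContra (φ : N → M) (K : ContraTensor J M) : ContraTensor I N := fun z ↦
  (mfderiv I J φ z).inverse ∘L K (φ z) ∘L
    ContinuousLinearMap.precomp ℝ (mfderiv I J φ z).inverse

theorem contraction_congr (T : ContraTensor I N) {f f' h h' : N → ℝ} {z : N}
    (hf : f =ᶠ[𝓝 z] f') (hh : h =ᶠ[𝓝 z] h') :
    contraction I T f h =ᶠ[𝓝 z] contraction I T f' h' := by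
  filter_upwards [hf.eventuallyEq_nhds, hh.eventuallyEq_nhds] with y h1 h2
  rw [contraction, contraction, mvfderiv_congr h1, mvfderiv_congr h2]

theorem schouten_congr_of_eventuallyEq (K G : ContraTensor I N) {z : N}
    {f₁ f₂ f₃ h₁ h₂ h₃ : N → ℝ} (e₁ : f₁ =ᶠ[𝓝 z] h₁) (e₂ : f₂ =ᶠ[𝓝 z] h₂) (e₃ : f₃ =ᶠ[𝓝 z] h₃) :
    schouten I K G f₁ f₂ f₃ z = schouten I K G h₁ h₂ h₃ z := by
  simp only [schouten_eq, schoutenTerm, mvfderiv_congr e₁, mvfderiv_congr e₂, mvfderiv_congr e₃,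
    mvfderiv_congr (contraction_congr K e₁ e₂), mvfderiv_congr (contraction_congr K e₂ e₃),
    mvfderiv_congr (contraction_congr K e₃ e₁), mvfderiv_congr (contraction_congr G e₁ e₂),
    mvfderiv_congr (contraction_congr G e₂ e₃), mvfderiv_congr (contraction_congr G e₃ e₁)]

theorem isInvertible_mfderiv {φ : N → M} (hφ : IsLocalDiffeomorph I J ∞ φ) (z : N) :
    (mfderiv I J φ z).IsInvertible :=
  ⟨hφ.mfderivToContinuousLinearEquiv (by simp) z, rfl⟩

theorem pushforward_pullbackContra {φ : N → M} (hφ : IsLocalDiffeomorph I J ∞ φ)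
    (K : ContraTensor J M) (z : N) :
    K (φ z) = pushforward I J φ z (pullbackContra I J φ K z) := by
  have hA := isInvertible_mfderiv hφ z
  ext1 p
  change K (φ z) p = mfderiv I J φ z ((mfderiv I J φ z).inverse (K (φ z)
    ((p ∘L mfderiv I J φ z) ∘L (mfderiv I J φ z).inverse)))
  rw [hA.self_apply_inverse, ContinuousLinearMap.comp_assoc, hA.self_comp_inverse,
    ContinuousLinearMap.comp_id]

theorem pushforward_injective {φ : N → M} (hφ : IsLocalDiffeomorph I J ∞ φ) (z : N)
    {T S : (TangentSpace I z →L[ℝ] ℝ) →L[ℝ] TangentSpace I z}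
    (h : pushforward I J φ z T = pushforward I J φ z S) : T = S := by
  have hA := isInvertible_mfderiv hφ z
  ext1 p
  have h1 := congrArg (fun L : (TangentSpace J (φ z) →L[ℝ] ℝ) →L[ℝ] TangentSpace J (φ z) ↦
    L (p ∘L (mfderiv I J φ z).inverse)) h
  change mfderiv I J φ z (T ((p ∘L (mfderiv I J φ z).inverse) ∘L mfderiv I J φ z)) =
    mfderiv I J φ z (S ((p ∘L (mfderiv I J φ z).inverse) ∘L mfderiv I J φ z)) at h1
  rw [ContinuousLinearMap.comp_assoc, hA.inverse_comp_self, ContinuousLinearMap.comp_id] at h1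
  exact hA.injective h1

theorem exists_local_function {φ : N → M} (hφ : IsLocalDiffeomorph I J ∞ φ) {z : N} {f : N → ℝ}
    (hf : ContMDiffAt I 𝓘(ℝ, ℝ) ∞ f z) :
    ∃ f' : M → ℝ, ContMDiffAt J 𝓘(ℝ, ℝ) ∞ f' (φ z) ∧ f' ∘ φ =ᶠ[𝓝 z] f := by
  refine ⟨f ∘ (hφ z).localInverse, ?_, ?_⟩
  · refine ContMDiffAt.comp (φ z) ?_ (hφ z).localInverse_contMDiffAt
    rwa [(hφ z).localInverse_left_inv (hφ z).localInverse_mem_target]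
  · filter_upwards [(hφ z).localInverse_eventuallyEq_left] with y hy
    exact congrArg f hy

variable [IsManifold J ∞ M]

theorem cometric_eq_pullbackContra [FiniteDimensional ℝ E'] {φ : N → M}
    (hφ : IsLocalDiffeomorph I J ∞ φ) {g : CovTensor J M} (hg : IsPseudoRiemannianMetric J g)
    {g' : CovTensor I N} (hiso : ∀ z, pullback I J φ z (g (φ z)) = g' z) :
    cometric I g' = pullbackContra I J φ (cometric J g) := by
  funext z
  have hA := isInvertible_mfderiv hφ z
  have hg' : ∀ v, g' z v = g (φ z) (mfderiv I J φ z v) ∘L mfderiv I J φ z := by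
    intro v
    rw [← hiso]
    rfl
  refine ContinuousLinearMap.inverse_eq ?_ ?_
  · ext1 p
    change g' z ((mfderiv I J φ z).inverse (cometric J g (φ z)
      (p ∘L (mfderiv I J φ z).inverse))) = p
    rw [hg', hA.self_apply_inverse, hg.apply_cometric, ContinuousLinearMap.comp_assoc,
      hA.inverse_comp_self, ContinuousLinearMap.comp_id]
  · ext1 v
    change (mfderiv I J φ z).inverse (cometric J g (φ z)
      (g' z v ∘L (mfderiv I J φ z).inverse)) = v
    rw [hg', ContinuousLinearMap.comp_assoc, hA.self_comp_inverse, ContinuousLinearMap.comp_id,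
      hg.cometric_apply, hA.inverse_apply_self]

variable [IsManifold I ∞ N]

theorem IsSymmetricTensorField.pullbackContra {φ : N → M} (hφ : IsLocalDiffeomorph I J ∞ φ)
    {K : ContraTensor J M} (hK : IsSymmetricTensorField J K) :
    IsSymmetricTensorField I (pullbackContra I J φ K) where
  symm z p q := hK.symm (φ z) (p ∘L (mfderiv I J φ z).inverse) (q ∘L (mfderiv I J φ z).inverse)
  smooth z f h hf hh := by
    obtain ⟨f', hf', ef⟩ := exists_local_function hφ hf
    obtain ⟨h', hh', eh⟩ := exists_local_function hφ hh
    have h1 := (hK.contMDiffAt hf' hh').comp z (hφ z).contMDiffAt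
    refine h1.congr_of_eventuallyEq ?_
    exact (contraction_congr _ ef.symm eh.symm).trans
      (contraction_comp_eventuallyEq (pushforward_pullbackContra hφ K) (hφ z).contMDiffAt
        hf' hh').symm

/-- The Killing equation is invariant under isometries onto open subsets. -/
theorem killingEquationOn_range_iff {φ : N → M} (hφ : IsLocalDiffeomorph I J ∞ φ)
    {K : ContraTensor J M} (hK : IsSymmetricTensorField J K) {g : CovTensor J M}
    (hG : IsSymmetricTensorField J (cometric J g)) {g' : CovTensor I N}
    (hg' : cometric I g' = pullbackContra I J φ (cometric J g)) :
    KillingEquationOn J g K (Set.range φ) ↔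
      KillingEquationOn I g' (pullbackContra I J φ K) Set.univ := by
  have key : ∀ (z : N) {f₁ f₂ f₃ : M → ℝ}, ContMDiffAt J 𝓘(ℝ, ℝ) ∞ f₁ (φ z) →
      ContMDiffAt J 𝓘(ℝ, ℝ) ∞ f₂ (φ z) → ContMDiffAt J 𝓘(ℝ, ℝ) ∞ f₃ (φ z) →
      schouten J K (cometric J g) f₁ f₂ f₃ (φ z) =
        schouten I (pullbackContra I J φ K) (cometric I g') (f₁ ∘ φ) (f₂ ∘ φ) (f₃ ∘ φ) z := by
    intro z f₁ f₂ f₃ h₁ h₂ h₃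
    rw [hg']
    exact schouten_pushforward (pushforward_pullbackContra hφ K)
      (pushforward_pullbackContra hφ (cometric J g)) (hφ z).contMDiffAt hK hG h₁ h₂ h₃
  constructor
  · intro h z _ f₁ f₂ f₃ h₁ h₂ h₃
    obtain ⟨f₁', h₁', e₁⟩ := exists_local_function hφ h₁
    obtain ⟨f₂', h₂', e₂⟩ := exists_local_function hφ h₂
    obtain ⟨f₃', h₃', e₃⟩ := exists_local_function hφ h₃
    rw [← schouten_congr_of_eventuallyEq _ _ e₁ e₂ e₃, ← key z h₁' h₂' h₃']
    exact h _ ⟨z, rfl⟩ _ _ _ h₁' h₂' h₃'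
  · rintro h _ ⟨z, rfl⟩ f₁ f₂ f₃ h₁ h₂ h₃
    rw [key z h₁ h₂ h₃]
    have hs := (hφ z).contMDiffAt
    exact h z trivial _ _ _ (h₁.comp z hs) (h₂.comp z hs) (h₃.comp z hs)

end Transport

section Invariance

variable {EB : Type*} [NormedAddCommGroup EB] [NormedSpace ℝ EB]
  {HB : Type*} [TopologicalSpace HB] {IB : ModelWithCorners ℝ EB HB}
  {B : Type*} [TopologicalSpace B] [ChartedSpace HB B] [IsManifold IB ∞ B]
  {EF : Type*} [NormedAddCommGroup EF] [NormedSpace ℝ EF] [FiniteDimensional ℝ EF]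
  {HF : Type*} [TopologicalSpace HF] {IF : ModelWithCorners ℝ EF HF}
  {F : Type*} [TopologicalSpace F] [ChartedSpace HF F] [IsManifold IF ∞ F]
  {E : Type*} [NormedAddCommGroup E] [NormedSpace ℝ E]
  {H : Type*} [TopologicalSpace H] {I : ModelWithCorners ℝ E H}
  {M : Type*} [TopologicalSpace M] [ChartedSpace H M]

/-- Invariance of `D` says that `K`, read on the warped product, is block diagonal. -/
theorem IsAdaptedWarpedProduct.isBlockDiagonal {g : CovTensor I M} {D : Distribution I M}
    {gB : CovTensor IB B} {gF : CovTensor IF F} {ρ : B → ℝ} {φ : B × F → M}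
    (hφ : IsAdaptedWarpedProduct IB IF I g D gB gF ρ φ) {K : ContraTensor I M}
    (hK : ∀ (x : M) (p q : TangentSpace I x →L[ℝ] ℝ), p (K x q) = q (K x p))
    (hKD : IsInvariant I g K D) : IsBlockDiagonal (pullbackContra (IB.prod IF) I φ K) := by
  have key : ∀ (z : B × F) (q : TangentSpace IF z.2 →L[ℝ] ℝ),
      mfderiv (IB.prod IF) IB Prod.fst z (pullbackContra (IB.prod IF) I φ K z
        (q ∘L mfderiv (IB.prod IF) IF Prod.snd z)) = 0 := by
    intro z q
    have hA := isInvertible_mfderiv hφ.localDiffeo z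
    set A := mfderiv (IB.prod IF) I φ z with hAdef
    set ι := mfderiv IF (IB.prod IF) (fun y : F ↦ (z.1, y)) z.2 with hι
    have hAι : mfderiv IF I (fun y : F ↦ φ (z.1, y)) z.2 = A ∘L ι :=
      mfderiv_comp z.2 ((hφ.localDiffeo z).mdifferentiableAt (by simp))
        (mdifferentiableAt_const.prodMk mdifferentiableAt_id)
    have hρz : ρ z.1 ^ 2 ≠ 0 := (pow_pos (hφ.warp_pos z.1) 2).ne'
    set w := (ρ z.1 ^ 2)⁻¹ • cometric IF gF z.2 q with hw
    have hfst : mfderiv (IB.prod IF) IB Prod.fst z ∘L ι = 0 := mfderiv_fst_comp_inclusion_fiber z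
    have hsnd : mfderiv (IB.prod IF) IF Prod.snd z ∘L ι = ContinuousLinearMap.id ℝ _ :=
      mfderiv_snd_comp_inclusion_fiber z
    have hfst' : ∀ v, mfderiv (IB.prod IF) IB Prod.fst z (ι v) = 0 := fun v ↦
      congrArg (fun L : TangentSpace IF z.2 →L[ℝ] TangentSpace IB z.1 ↦ L v) hfst
    have hsnd' : ∀ v, mfderiv (IB.prod IF) IF Prod.snd z (ι v) = v := fun v ↦
      congrArg (fun L : TangentSpace IF z.2 →L[ℝ] TangentSpace IF z.2 ↦ L v) hsnd
    have hq : q ∘L mfderiv (IB.prod IF) IF Prod.snd z = g (φ z) (A (ι w)) ∘L A := by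
      have h1 : g (φ z) (A (ι w)) ∘L A = warpedMetric IB IF gB gF ρ z (ι w) := by
        rw [← hφ.isometry]
        rfl
      rw [h1, warpedMetric_apply, hfst', hsnd', hw, map_smul, hφ.metric_fiber.apply_cometric,
        map_zero, ContinuousLinearMap.zero_comp, zero_add, ContinuousLinearMap.smul_comp, smul_smul,
        mul_inv_cancel₀ hρz, one_smul]
    have hmem : A (ι w) ∈ D (φ z) := by
      rw [← hφ.adapted_fiber z.1 z.2, hAι]
      exact ⟨w, rfl⟩
    have hmem' := hKD (φ z) _ hmem
    rw [← hφ.adapted_fiber z.1 z.2, hAι] at hmem'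
    obtain ⟨w', hw'⟩ := hmem'
    change mfderiv (IB.prod IF) IB Prod.fst z (A.inverse (K (φ z)
      ((q ∘L mfderiv (IB.prod IF) IF Prod.snd z) ∘L A.inverse))) = 0
    have hw'' : K (φ z) (g (φ z) (A (ι w))) = A (ι w') := hw'.symm
    rw [hq, ContinuousLinearMap.comp_assoc, hA.self_comp_inverse, ContinuousLinearMap.comp_id,
      hw'', hA.inverse_apply_self, hfst']
  refine ⟨fun z p q ↦ by rw [key, map_zero], fun z p q ↦ ?_⟩
  have h1 := hK (φ z) ((q ∘L mfderiv (IB.prod IF) IF Prod.snd z) ∘L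
    (mfderiv (IB.prod IF) I φ z).inverse) ((p ∘L mfderiv (IB.prod IF) IB Prod.fst z) ∘L
    (mfderiv (IB.prod IF) I φ z).inverse)
  refine h1.trans ?_
  exact (congrArg p (key z q)).trans (map_zero p)

end Invariance

end WarpedKilling

end

open WarpedKilling in
theorem mainTheorem2
    {EB : Type*} [NormedAddCommGroup EB] [NormedSpace ℝ EB] [FiniteDimensional ℝ EB]
    {HB : Type*} [TopologicalSpace HB] (IB : ModelWithCorners ℝ EB HB) [IB.Boundaryless]
    {B : Type*} [TopologicalSpace B] [ChartedSpace HB B] [IsManifold IB ∞ B] [ConnectedSpace B]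
    {EF : Type*} [NormedAddCommGroup EF] [NormedSpace ℝ EF] [FiniteDimensional ℝ EF]
    {HF : Type*} [TopologicalSpace HF] (IF : ModelWithCorners ℝ EF HF) [IF.Boundaryless]
    {F : Type*} [TopologicalSpace F] [ChartedSpace HF F] [IsManifold IF ∞ F] [ConnectedSpace F]
    {E : Type*} [NormedAddCommGroup E] [NormedSpace ℝ E] [FiniteDimensional ℝ E]
    {H : Type*} [TopologicalSpace H] (I : ModelWithCorners ℝ E H) [I.Boundaryless]
    {M : Type*} [TopologicalSpace M] [ChartedSpace H M] [IsManifold I ∞ M]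
    (g : CovTensor I M) (hg : IsPseudoRiemannianMetric I g)
    (K : ContraTensor I M) (hK : IsSymmetricTensorField I K)
    (D : Distribution I M) (hD : IsKillingDistribution I g D) (hKD : IsInvariant I g K D)
    (gB : CovTensor IB B) (gF : CovTensor IF F) (ρ : B → ℝ) (φ : B × F → M)
    (hφ : IsAdaptedWarpedProduct IB IF I g D gB gF ρ φ) :
    (KillingEquationOn I g K (Set.range φ) ↔
      ∃ (K' : ContraTensor IB B) (Kt : ContraTensor IF F) (t : B → ℝ),
        IsKillingTensor IB gB K' ∧ IsKillingTensor IF gF Kt ∧ ContMDiff IB 𝓘(ℝ, ℝ) ∞ t ∧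
        (∀ z : B × F, K (φ z) = pushforward (IB.prod IF) I φ z
          (liftBase IB IF K' z + t z.1 • liftFiber IB IF (cometric IF gF) z
            + liftFiber IB IF Kt z)) ∧
        (∀ b : B, mvfderiv IB t b = gB b (K' b (mvfderiv IB (fun b' ↦ (ρ b' ^ 2)⁻¹) b)))) ∧
    (∀ Kt : ContraTensor IF F, IsKillingTensor IF gF Kt →
      IsKillingTensor (IB.prod IF) (warpedMetric IB IF gB gF ρ) (liftFiber IB IF Kt)) := by
  have hB := hφ.metric_base
  have hF := hφ.metric_fiber
  have hρs := hφ.warp_smooth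
  have hρ := hφ.warp_pos
  have hloc := hφ.localDiffeo
  have hiff := killingEquationOn_range_iff hloc hK hg.isSymmetricTensorField_cometric
    (cometric_eq_pullbackContra hloc hg hφ.isometry)
  refine ⟨⟨fun hkill ↦ ?_, ?_⟩, fun Kt hKt ↦ hKt.liftFiber hB hF hρs hρ⟩
  · obtain ⟨K', Kt, t, h₁, h₂, h₃, h₄, h₅⟩ := exists_decomposition hφ.fiber_dim_pos hB hF hρs hρ
      (hK.pullbackContra hloc) (hφ.isBlockDiagonal hK.symm hKD) (hiff.1 hkill)
    refine ⟨K', Kt, t, h₁, h₂, h₃, fun z ↦ ?_, h₅⟩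
    rw [← h₄ z]
    exact pushforward_pullbackContra hloc K z
  · rintro ⟨K', Kt, t, h₁, h₂, h₃, h₄, h₅⟩
    rw [hiff]
    have hKe : pullbackContra (IB.prod IF) I φ K = fun z ↦ liftBase IB IF K' z
        + t z.1 • liftFiber IB IF (cometric IF gF) z + liftFiber IB IF Kt z :=
      funext fun z ↦ pushforward_injective hloc z
        ((pushforward_pullbackContra hloc K z).symm.trans (h₄ z))
    rw [hKe]
    exact killingEquationOn_lift_add_add hB hF hρs hρ h₁ h₂ h₃ h₅
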